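/- Let $\mathcal H$ be a complex Hilbert space, let $\mathcal B(\mathcal H)$ be the algebra of bounded operators on $\mathcal H$, and let $$\mathcal R=\{(P,f)\in\mathcal B(\mathcal H)\times\mathcal H:\ P=P^2=P^*,\ Pf=f,\ \|f\|=1\}\subset \mathcal B(\mathcal H)\times\mathcal H .$$ The tangent space of $\mathcal R$ at $(P,f)$ is $(T\mathcal R)_{(P,f)}=\{(XP-PX,Xf): X\in\mathcal B(\mathcal H),\ X^*=-X\}$. A lifting of $V\in(T\mathcal R)_{(P,f)}$ is an operator $X\in\mathcal B(\mathcal H)$ with $X^*=-X$ and $(XP-PX,Xf)=V$. Endow $\mathcal R$ with the quotient Finsler metric $$|V|_{(P,f)}=\inf\{\|X\|: X \text{ is a lifting of } V\},$$ where $\|\cdot\|$ is the operator norm; a lifting $X_0$ of $V$ is called minimal if $\|X_0\|=|V|_{(P,f)}$. The length of a piecewise smooth curve $\gamma:[c,d]\to\mathcal R$ is $L(\gamma)=\int_c^d|\dot\gamma(t)|_{\gamma(t)}\,dt$. **Theorem.** Let $(P_0,f_0)\in\mathcal R$, let $V\in(T\mathcal R)_{(P_0,f_0)}$ with $|V|_{(P_0,f_0)}=1$,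 let $X_0$ be a minimal lifting of $V$, and put $$\delta(t)=(e^{tX_0}P_0e^{-tX_0},\,e^{tX_0}f_0),\qquad t\in\mathbb R .$$ Then, for every real $t$ with $|t|\le\pi/2$, the arc of the curve $\delta$ between the parameters $0$ and $t$ is a piecewise smooth curve in $\mathcal R$ of minimal length among all piecewise smooth curves in $\mathcal R$ with the same endpoints. More generally, the same holds for the arc $\delta|_{[a,b]}$ whenever $a\le b$ and $b-a\le\pi/2$. -/

import Mathlib

open scoped ContDiff

/-- The total space `R` of the canonical sphere bundle over the Grassmannian of `H`: pairs `(P, f)`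
with `P` an orthogonal projection of `H` and `f` a unit vector in the range of `P`. It is a smooth
submanifold of the Banach space `B(H) × H`. -/
def canonicalSphereBundle (H : Type*) [NormedAddCommGroup H] [InnerProductSpace ℂ H]
    [CompleteSpace H] : Set ((H →L[ℂ] H) × H) :=
  {p | IsStarProjection p.1 ∧ p.1 p.2 = p.2 ∧ ‖p.2‖ = 1}

namespace canonicalSphereBundle

variable {H : Type*} [NormedAddCommGroup H] [InnerProductSpace ℂ H] [CompleteSpace H]

/-- The differential at `1` of `U ↦ (U P U⋆, U f)`, that is `X ↦ (X P - P X, X f)`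
(on all of `B(H)`; it is used on anti-Hermitian operators). -/
noncomputable def infinitesimalAction (p : (H →L[ℂ] H) × H) : (H →L[ℂ] H) →ₗ[ℝ] (H →L[ℂ] H) × H where
  toFun X := (X * p.1 - p.1 * X, X p.2)
  map_add' X Y := by
    ext1
    · simp only [add_mul, mul_add, Prod.fst_add]; abel
    · simp
  map_smul' r X := by
    ext1
    · simp [smul_sub]
    · simp

/-- The tangent space of `R` at `p = (P, f)`: all `(X P - P X, X f)` with `X` anti-Hermitian. -/
noncomputable def tangentSpace (p : (H →L[ℂ] H) × H) : Submodule ℝ ((H →L[ℂ] H) × H) :=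
  (skewAdjoint.submodule ℝ (H →L[ℂ] H)).map (infinitesimalAction p)

/-- `X` is a lifting of `V`: an anti-Hermitian operator with `(X P - P X, X f) = V`. -/
def IsLifting (p V : (H →L[ℂ] H) × H) (X : H →L[ℂ] H) : Prop :=
  X ∈ skewAdjoint (H →L[ℂ] H) ∧ infinitesimalAction p X = V

/-- The quotient Finsler norm `|V|_p` of a tangent vector `V` at `p`: the infimum of the operator
norms of the liftings of `V`. -/
noncomputable def finslerNorm (p V : (H →L[ℂ] H) × H) : ℝ :=
  sInf {r : ℝ | ∃ X : H →L[ℂ] H, IsLifting p V X ∧ ‖X‖ = r}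

/-- A minimal lifting is a lifting at which the quotient norm is attained. -/
def IsMinimalLifting (p V : (H →L[ℂ] H) × H) (X : H →L[ℂ] H) : Prop :=
  IsLifting p V X ∧ ‖X‖ = finslerNorm p V

/-- `γ` is a piecewise smooth curve in `R` on the parameter interval `[a, b]`: it is continuous with
values in `R`, and there are finitely many break points such that `γ` is `C^∞` (up to the ends) on
each closed subinterval without break point in its interior. -/
def IsPiecewiseSmoothCurve (γ : ℝ → (H →L[ℂ] H) × H) (a b : ℝ) : Prop :=
  a ≤ b ∧ (∀ t ∈ Set.Icc a b, γ t ∈ canonicalSphereBundle H) ∧ ContinuousOn γ (Set.Icc a b) ∧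
    ∃ s : Finset ℝ, ∀ c d : ℝ, a ≤ c → c < d → d ≤ b → (∀ t ∈ s, t ∉ Set.Ioo c d) →
      ContDiffOn ℝ ∞ γ (Set.Icc c d)

/-- The Finsler length `∫ₐᵇ |γ'(t)|_{γ(t)} dt` (the value of `deriv` at the finitely many
break points and at the ends does not matter). -/
noncomputable def length (γ : ℝ → (H →L[ℂ] H) × H) (a b : ℝ) : ENNReal :=
  ∫⁻ t in Set.Icc a b, ENNReal.ofReal (finslerNorm (γ t) (deriv γ t))

/-- `γ` restricted to `[a, b]` is a piecewise smooth curve in `R`, and no piecewise smooth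
curve in `R`, on any parameter interval, with the same initial and final points is shorter. -/
def HasMinimalLength (γ : ℝ → (H →L[ℂ] H) × H) (a b : ℝ) : Prop :=
  IsPiecewiseSmoothCurve γ a b ∧
    ∀ (η : ℝ → (H →L[ℂ] H) × H) (c d : ℝ), IsPiecewiseSmoothCurve η c d →
      η c = γ a → η d = γ b → length γ a b ≤ length η c d

/-- The curve `t ↦ e^{tX} · (P, f) = (e^{tX} P e^{-tX}, e^{tX} f)`. -/
noncomputable def expCurve (p : (H →L[ℂ] H) × H) (X : H →L[ℂ] H) (t : ℝ) : (H →L[ℂ] H) × H :=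
  (NormedSpace.exp (t • X) * p.1 * NormedSpace.exp (-(t • X)), NormedSpace.exp (t • X) p.2)

end canonicalSphereBundle

/-! ### Positive functionals and the semi-inner product they define -/

namespace canonicalSphereBundle

variable {H : Type*} [NormedAddCommGroup H] [InnerProductSpace ℂ H]

/-! The orbit is compared with a sphere. A state `φ` makes `φ (star a * b)` a real semi-inner
product on operators; in GNS terms it is the real inner product of `a ξ` and `b ξ`, with `ξ` the
cyclic vector, so unitaries give unit vectors.

Minimality of `X` says that `X` has distance one to the isotropy algebra. Hahn–Banach turns this
into a state with `X² ξ = -ξ` and `X ξ` orthogonal to the complexified isotropy algebra applied to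
`ξ` (`exists_state_of_norm_le_norm_add`). Hence `e^{tX} ξ` runs along a great circle which leaves
`ξ` orthogonally to the isotropy directions.

Fix `w = e^{tX}` and let `orbitAngle` at `q` be the least angle between `w ξ` and the vectors `u ξ`,
where `u` is unitary and takes `p` to `q`. It vanishes at `e^{tX} · p`. At `p` it is at least `t`
when `t ≤ π/2` (`le_orbitAngle`): the inner product of `w ξ` with `u ξ`, for `u` fixing `p`, is `cos
t` times a number at most one. Along any curve its rate of change is at most the Finsler speed
(`abs_deriv_orbitAngle_le`), since nearby points are joined by unitaries as close to `1` as a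
lifting of the velocity predicts. Integration gives length at least `t`. Along the exponential curve
`X` itself lifts the velocity, so the speed is at most one and the bound is attained. -/

/-- A real-linear functional on `B(H)` which is nonnegative on all operators with nonnegative
numerical real part. It is the real part of a positive complex-linear functional. -/
def IsPositiveFunctional (φ : (H →L[ℂ] H) →L[ℝ] ℝ) : Prop :=
  ∀ a : H →L[ℂ] H, (∀ x, 0 ≤ a.reApplyInnerSelf x) → 0 ≤ φ a

lemma reApplyInnerSelf_add (a b : H →L[ℂ] H) (x : H) :
    (a + b).reApplyInnerSelf x = a.reApplyInnerSelf x + b.reApplyInnerSelf x := by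
  simp [ContinuousLinearMap.reApplyInnerSelf_apply, inner_add_left]

lemma reApplyInnerSelf_neg (a : H →L[ℂ] H) (x : H) :
    (-a).reApplyInnerSelf x = -a.reApplyInnerSelf x := by
  simp [ContinuousLinearMap.reApplyInnerSelf_apply, inner_neg_left]

lemma reApplyInnerSelf_sub (a b : H →L[ℂ] H) (x : H) :
    (a - b).reApplyInnerSelf x = a.reApplyInnerSelf x - b.reApplyInnerSelf x := by
  simp [ContinuousLinearMap.reApplyInnerSelf_apply, inner_sub_left]

lemma reApplyInnerSelf_real_smul (r : ℝ) (a : H →L[ℂ] H) (x : H) :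
    (r • a).reApplyInnerSelf x = r * a.reApplyInnerSelf x := by
  have : (r • a) x = ((r : ℂ)) • a x := by simp
  rw [ContinuousLinearMap.reApplyInnerSelf_apply, this, inner_smul_left]
  simp [ContinuousLinearMap.reApplyInnerSelf_apply]

lemma reApplyInnerSelf_one (x : H) :
    (1 : H →L[ℂ] H).reApplyInnerSelf x = ‖x‖ ^ 2 := by
  simp [ContinuousLinearMap.reApplyInnerSelf_apply, ← Complex.ofReal_pow]

lemma abs_reApplyInnerSelf_le (a : H →L[ℂ] H) (x : H) :
    |a.reApplyInnerSelf x| ≤ ‖a‖ * ‖x‖ ^ 2 := by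
  rw [ContinuousLinearMap.reApplyInnerSelf_apply]
  calc _ ≤ ‖inner ℂ (a x) x‖ := RCLike.abs_re_le_norm _
    _ ≤ ‖a x‖ * ‖x‖ := norm_inner_le_norm _ _
    _ ≤ ‖a‖ * ‖x‖ * ‖x‖ := by gcongr; exact a.le_opNorm x
    _ = _ := by ring

lemma IsPositiveFunctional.apply_le_norm_mul {φ : (H →L[ℂ] H) →L[ℝ] ℝ}
    (hφ : IsPositiveFunctional φ) (a : H →L[ℂ] H) :
    φ a ≤ ‖a‖ * φ 1 := by
  have := hφ (‖a‖ • 1 - a) fun x => by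
    rw [reApplyInnerSelf_sub, reApplyInnerSelf_real_smul, reApplyInnerSelf_one]
    linarith [le_abs_self (a.reApplyInnerSelf x), abs_reApplyInnerSelf_le a x]
  rw [map_sub, map_smul, smul_eq_mul] at this
  linarith

variable [CompleteSpace H]

lemma reApplyInnerSelf_star (a : H →L[ℂ] H) (x : H) :
    (star a).reApplyInnerSelf x = a.reApplyInnerSelf x := by
  simp only [ContinuousLinearMap.reApplyInnerSelf_apply, ContinuousLinearMap.star_eq_adjoint,
    ContinuousLinearMap.adjoint_inner_left]
  exact inner_re_symm (𝕜 := ℂ) _ _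

lemma reApplyInnerSelf_star_mul_self (a : H →L[ℂ] H) (x : H) :
    (star a * a).reApplyInnerSelf x = ‖a x‖ ^ 2 := by
  simp [ContinuousLinearMap.reApplyInnerSelf_apply, ContinuousLinearMap.star_eq_adjoint,
    ContinuousLinearMap.adjoint_inner_left, ← Complex.ofReal_pow]

lemma norm_le_of_abs_reApplyInnerSelf_le {k : H →L[ℂ] H} (hk : IsSelfAdjoint k) {r : ℝ}
    (hr : 0 ≤ r) (h : ∀ x, |k.reApplyInnerSelf x| ≤ r * ‖x‖ ^ 2) : ‖k‖ ≤ r := by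
  rw [k.norm_eq_iSup_rayleighQuotient hk.isSymmetric]
  refine ciSup_le fun x => ?_
  rw [ContinuousLinearMap.rayleighQuotient, abs_div, abs_of_nonneg (sq_nonneg ‖x‖)]
  exact div_le_of_le_mul₀ (sq_nonneg _) hr (h x)

namespace IsPositiveFunctional

variable {φ : (H →L[ℂ] H) →L[ℝ] ℝ}

lemma apply_star (hφ : IsPositiveFunctional φ) (a : H →L[ℂ] H) : φ (star a) = φ a := by
  have h1 := hφ (star a - a) fun x => by simp [reApplyInnerSelf_sub, reApplyInnerSelf_star]
  have h2 := hφ (a - star a) fun x => by simp [reApplyInnerSelf_sub, reApplyInnerSelf_star]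
  rw [map_sub] at h1 h2
  linarith

lemma apply_eq_zero_of_star_eq_neg (hφ : IsPositiveFunctional φ) {a : H →L[ℂ] H}
    (ha : star a = -a) : φ a = 0 := by
  have := hφ.apply_star a
  rw [ha, map_neg] at this
  linarith

lemma apply_star_mul_self_nonneg (hφ : IsPositiveFunctional φ) (a : H →L[ℂ] H) :
    0 ≤ φ (star a * a) :=
  hφ _ fun x => by rw [reApplyInnerSelf_star_mul_self]; positivity

lemma apply_star_mul_comm (hφ : IsPositiveFunctional φ) (a b : H →L[ℂ] H) :
    φ (star a * b) = φ (star b * a) := by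
  rw [← hφ.apply_star]; simp

/-- The Cauchy–Schwarz inequality for a positive functional. -/
lemma apply_star_mul_sq_le (hφ : IsPositiveFunctional φ) (a b : H →L[ℂ] H) :
    φ (star a * b) ^ 2 ≤ φ (star a * a) * φ (star b * b) := by
  have key : ∀ r : ℝ, 0 ≤ φ (star a * a) * (r * r) + (2 * φ (star a * b)) * r + φ (star b * b) := by
    intro r
    have h := hφ.apply_star_mul_self_nonneg (r • a + b)
    have e : star (r • a + b) * (r • a + b)
        = (r * r) • (star a * a) + r • (star a * b) + r • (star b * a) + star b * b := by
      simp only [star_add, star_smul, star_trivial, add_mul, mul_add, smul_mul_assoc,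
        mul_smul_comm]
      module
    rw [e, map_add, map_add, map_add, map_smul, map_smul, map_smul, smul_eq_mul, smul_eq_mul,
      smul_eq_mul, hφ.apply_star_mul_comm b a] at h
    linarith
  have := discrim_le_zero key
  rw [discrim] at this
  linarith

/-- Cauchy–Schwarz against `star c`: an operator that kills the cyclic vector still does so after
left multiplication. -/
lemma apply_mul_eq_zero (hφ : IsPositiveFunctional φ) {b : H →L[ℂ] H} (hb : φ (star b * b) ≤ 0)
    (c : H →L[ℂ] H) : φ (c * b) = 0 := by
  have h := hφ.apply_star_mul_sq_le (star c) b
  rw [star_star, le_antisymm hb (hφ.apply_star_mul_self_nonneg b), mul_zero] at h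
  exact pow_eq_zero_iff two_ne_zero |>.1 (le_antisymm h (sq_nonneg _))

/-- If a positive functional attains its norm at a self-adjoint contraction `h`, then `h` acts as
the identity in the associated representation. -/
lemma apply_mul_of_apply_eq (hφ : IsPositiveFunctional φ) {h : H →L[ℂ] H} (hh : IsSelfAdjoint h)
    (hn : ‖h‖ ≤ 1) (h1 : φ 1 ≤ φ h) (c : H →L[ℂ] H) : φ (c * h) = φ c := by
  have h2 : 0 ≤ φ (1 - star h * h) := hφ _ fun x => by
    rw [reApplyInnerSelf_sub, reApplyInnerSelf_one, reApplyInnerSelf_star_mul_self]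
    have : ‖h x‖ ≤ ‖x‖ := (h.le_of_opNorm_le hn x).trans_eq (one_mul _)
    have := pow_le_pow_left₀ (norm_nonneg _) this 2
    linarith
  have h3 : φ (star (1 - h) * (1 - h)) ≤ 0 := by
    rw [show star (1 - h) * (1 - h) = 1 + star h * h - h - h by
      simp [hh.star_eq, mul_sub, sub_mul]; abel]
    simp only [map_sub, map_add] at h2 ⊢
    linarith
  have := hφ.apply_mul_eq_zero h3 c
  rw [mul_sub, mul_one, map_sub] at this
  linarith

end IsPositiveFunctional

/-! ### Hahn–Banach duality for minimal liftings -/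

/-- Duality: if the distance of the self-adjoint operator `h` to the self-adjoint part of the
self-adjoint subspace `B` is at least one, there are two positive functionals of total mass one
that agree on the self-adjoint part of `B` and whose difference is at least one at `h`. -/
lemma exists_isPositiveFunctional_pair {h : H →L[ℂ] H} (hh : IsSelfAdjoint h)
    (B : Submodule ℂ (H →L[ℂ] H))
    (hmin : ∀ b ∈ B, IsSelfAdjoint b → 1 ≤ ‖h + b‖) :
    ∃ φ ψ : (H →L[ℂ] H) →L[ℝ] ℝ, IsPositiveFunctional φ ∧ IsPositiveFunctional ψ ∧
      φ 1 + ψ 1 = 1 ∧ 1 ≤ φ h - ψ h ∧ ∀ b ∈ B, IsSelfAdjoint b → φ b = ψ b := by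
  -- The two components encode the bounds `h + b < 1` and `-(h + b) < 1` uniformly. Thus `N` meets
  -- `T` only if some `h + b` has norm below one.
  let N : Set ((H →L[ℂ] H) × (H →L[ℂ] H)) := {p | ∃ ε > 0, ∀ x,
    p.1.reApplyInnerSelf x ≤ -ε * ‖x‖ ^ 2 ∧ p.2.reApplyInnerSelf x ≤ -ε * ‖x‖ ^ 2}
  let T : Set ((H →L[ℂ] H) × (H →L[ℂ] H)) :=
    {p | ∃ b ∈ B, IsSelfAdjoint b ∧ p = (h + b - 1, -(h + b) - 1)}
  have hNc : Convex ℝ N := by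
    rintro p ⟨ε, hε, hp⟩ q ⟨δ, hδ, hq⟩ s t hs ht hst
    refine ⟨s * ε + t * δ, ?_, fun x => ?_⟩
    · rcases hs.eq_or_lt with rfl | hs'
      · obtain rfl : t = 1 := by linarith
        simpa using hδ
      · nlinarith [mul_pos hs' hε, mul_nonneg ht hδ.le]
    · simp only [Prod.fst_add, Prod.snd_add, Prod.smul_fst, Prod.smul_snd, reApplyInnerSelf_add,
        reApplyInnerSelf_real_smul]
      have h1 := mul_le_mul_of_nonneg_left (hp x).1 hs
      have h2 := mul_le_mul_of_nonneg_left (hp x).2 hs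
      have h3 := mul_le_mul_of_nonneg_left (hq x).1 ht
      have h4 := mul_le_mul_of_nonneg_left (hq x).2 ht
      constructor <;> linarith
  have hNo : IsOpen N := by
    rw [Metric.isOpen_iff]
    rintro p ⟨ε, hε, hp⟩
    refine ⟨ε / 2, by positivity, fun q hq => ⟨ε / 2, by positivity, fun x => ?_⟩⟩
    rw [Metric.mem_ball, dist_eq_norm] at hq
    have h1 : ‖q.1 - p.1‖ ≤ ε / 2 := (norm_fst_le (q - p)).trans hq.le
    have h2 : ‖q.2 - p.2‖ ≤ ε / 2 := (norm_snd_le (q - p)).trans hq.le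
    have h3 := (le_abs_self _).trans (abs_reApplyInnerSelf_le (q.1 - p.1) x)
    have h4 := (le_abs_self _).trans (abs_reApplyInnerSelf_le (q.2 - p.2) x)
    rw [reApplyInnerSelf_sub] at h3 h4
    have h5 := mul_le_mul_of_nonneg_right h1 (sq_nonneg ‖x‖)
    have h6 := mul_le_mul_of_nonneg_right h2 (sq_nonneg ‖x‖)
    have := hp x
    constructor <;> linarith
  have hTc : Convex ℝ T := by
    rintro p ⟨b, hb, hb', rfl⟩ q ⟨c, hc, hc', rfl⟩ s t hs ht hst
    refine ⟨s • b + t • c, ?_, ?_, ?_⟩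
    · have := B.add_mem (B.smul_mem (s : ℂ) hb) (B.smul_mem (t : ℂ) hc)
      simpa using this
    · exact ((IsSelfAdjoint.all s).smul hb').add ((IsSelfAdjoint.all t).smul hc')
    · obtain rfl : s = 1 - t := by linarith
      ext1 <;> simp <;> module
  have hdisj : Disjoint N T := by
    rw [Set.disjoint_left]
    rintro _ ⟨ε, hε, hN⟩ ⟨b, hb, hb', rfl⟩
    -- The maximum with `0` covers `ε > 1`, as the numerical bound on the norm needs a nonnegative
    -- constant.
    have hle : ‖h + b‖ ≤ max (1 - ε) 0 := by
      refine norm_le_of_abs_reApplyInnerSelf_le (hh.add hb') (le_max_right _ _) fun x => ?_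
      have := hN x
      simp only [reApplyInnerSelf_sub, reApplyInnerSelf_neg, reApplyInnerSelf_one] at this
      have h1 := mul_le_mul_of_nonneg_right (le_max_left (1 - ε) 0) (sq_nonneg ‖x‖)
      rw [abs_le]
      constructor <;> linarith
    have := hmin b hb hb'
    rcases le_max_iff.1 (this.trans hle) with h | h <;> linarith
  obtain ⟨f, u, hfN, hfT⟩ := geometric_hahn_banach_open hNc hNo hTc hdisj
  have hcone : ∀ p ∈ N, ∀ s : ℝ, 0 < s → s • p ∈ N := by
    rintro p ⟨ε, hε, hp⟩ s hs
    refine ⟨s * ε, by positivity, fun x => ?_⟩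
    simp only [Prod.smul_fst, Prod.smul_snd, reApplyInnerSelf_real_smul]
    have h1 := mul_le_mul_of_nonneg_left (hp x).1 hs.le
    have h2 := mul_le_mul_of_nonneg_left (hp x).2 hs.le
    constructor <;> linarith
  have hone : ((-1, -1) : (H →L[ℂ] H) × (H →L[ℂ] H)) ∈ N :=
    ⟨1, one_pos, fun x => by simp [reApplyInnerSelf_neg, reApplyInnerSelf_one]⟩
  have hu : 0 ≤ u := by
    by_contra! hu
    have h1 := hfN _ hone
    set m := f (-1, -1)
    -- Rescaling inside the cone gives `f` the value `u / 2`, which exceeds `u` when `u < 0`.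
    have h2 := hfN _ (hcone _ hone (u / (2 * m)) (by
      have : m < 0 := h1.trans hu
      exact div_pos_of_neg_of_neg hu (by linarith)))
    rw [map_smul, smul_eq_mul] at h2
    have : m ≠ 0 := (h1.trans hu).ne
    have e : u / (2 * m) * m = u / 2 := by field_simp
    change u / (2 * m) * m < u at h2
    linarith
  have hle : ∀ p ∈ N, f p ≤ 0 := by
    intro p hp
    by_contra! h0
    have h2 := hfN _ (hcone _ hp ((u + 1) / f p) (by positivity))
    rw [map_smul, smul_eq_mul, div_mul_cancel₀ _ h0.ne'] at h2
    linarith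
  have hnonneg : ∀ p : (H →L[ℂ] H) × (H →L[ℂ] H), (∀ x, 0 ≤ p.1.reApplyInnerSelf x ∧
      0 ≤ p.2.reApplyInnerSelf x) → 0 ≤ f p := by
    intro p hp
    refine le_of_forall_pos_le_add fun ε hε => ?_
    have hm : 0 ≤ f (1, 1) := by
      have := hle _ hone
      rw [show ((-1, -1) : (H →L[ℂ] H) × (H →L[ℂ] H)) = -(1, 1) by simp, map_neg] at this
      linarith
    -- A small multiple of `(1, 1)` pushes `-p` into the open cone `N`; the `+ 1` keeps the
    -- denominator positive even if `f (1, 1) = 0`.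
    have := hle (-p - (ε / (f (1, 1) + 1)) • (1, 1)) ⟨ε / (f (1, 1) + 1), by positivity, fun x => by
      simp only [Prod.fst_sub, Prod.snd_sub, Prod.fst_neg, Prod.snd_neg, Prod.smul_fst,
        Prod.smul_snd, reApplyInnerSelf_real_smul, reApplyInnerSelf_sub, reApplyInnerSelf_neg,
        reApplyInnerSelf_one]
      have := hp x
      constructor <;> linarith⟩
    rw [map_sub, map_neg, map_smul, smul_eq_mul] at this
    have h3 : ε / (f (1, 1) + 1) * f (1, 1) ≤ ε := by
      rw [div_mul_eq_mul_div, div_le_iff₀ (by positivity)]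
      nlinarith
    linarith
  have hpos : 0 < f (1, 1) := by
    refine lt_of_le_of_ne (hnonneg _ fun x => by simp [reApplyInnerSelf_one]) fun h0 => ?_
    have hz : ∀ p, f p ≤ 0 := by
      intro p
      have := hnonneg (‖p‖ • (1, 1) - p) fun x => by
        simp only [Prod.fst_sub, Prod.snd_sub, Prod.smul_fst, Prod.smul_snd,
          reApplyInnerSelf_real_smul, reApplyInnerSelf_sub, reApplyInnerSelf_one]
        have h1 := (le_abs_self _).trans (abs_reApplyInnerSelf_le p.1 x)
        have h2 := (le_abs_self _).trans (abs_reApplyInnerSelf_le p.2 x)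
        have h3 := mul_le_mul_of_nonneg_right (norm_fst_le p) (sq_nonneg ‖x‖)
        have h4 := mul_le_mul_of_nonneg_right (norm_snd_le p) (sq_nonneg ‖x‖)
        constructor <;> linarith
      rw [map_sub, map_smul, ← h0] at this
      simpa using this
    have h1 := hfN _ hone
    have h2 := hfT _ ⟨0, B.zero_mem, .zero _, rfl⟩
    have h3 := hz (-(-1, -1))
    rw [map_neg] at h3
    linarith [hz (h + 0 - 1, -(h + 0) - 1)]
  set m := f (1, 1) with hm
  let φ : (H →L[ℂ] H) →L[ℝ] ℝ := m⁻¹ • f.comp (ContinuousLinearMap.inl ℝ _ _)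
  let ψ : (H →L[ℂ] H) →L[ℝ] ℝ := m⁻¹ • f.comp (ContinuousLinearMap.inr ℝ _ _)
  have hφ : ∀ a, φ a = m⁻¹ * f (a, 0) := fun a => rfl
  have hψ : ∀ a, ψ a = m⁻¹ * f (0, a) := fun a => rfl
  have hsum : ∀ a b, φ a + ψ b = m⁻¹ * f (a, b) := fun a b => by
    rw [hφ, hψ, ← mul_add, ← map_add]; simp
  have h1 : φ 1 + ψ 1 = 1 := by rw [hsum, inv_mul_cancel₀ hpos.ne']
  have hT : ∀ b ∈ B, IsSelfAdjoint b → 1 ≤ φ (h + b) - ψ (h + b) := by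
    intro b hb hb'
    have := hu.trans (hfT _ ⟨b, hb, hb', rfl⟩)
    have := mul_nonneg (inv_nonneg.2 hpos.le) this
    rw [← hsum, map_sub, map_sub, map_neg] at this
    linarith
  refine ⟨φ, ψ, fun a ha => ?_, fun a ha => ?_, h1, ?_, fun b hb hb' => ?_⟩
  · exact mul_nonneg (inv_nonneg.2 hpos.le) (hnonneg _ fun x => ⟨ha x, by
      simp [ContinuousLinearMap.reApplyInnerSelf_apply]⟩)
  · exact mul_nonneg (inv_nonneg.2 hpos.le) (hnonneg _ fun x => ⟨by
      simp [ContinuousLinearMap.reApplyInnerSelf_apply], ha x⟩)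
  · simpa using hT 0 B.zero_mem (.zero _)
  · by_contra hne
    set d := φ b - ψ b with hd
    have hd0 : d ≠ 0 := sub_ne_zero.2 hne
    set e := φ h - ψ h
    -- If `φ - ψ` were nonzero at `b`, this multiple of `b` would cancel its value at `h`, against
    -- the lower bound one.
    have := hT ((-e / d) • b) (B.smul_mem ((-e / d : ℝ) : ℂ) hb)
      ((IsSelfAdjoint.all _).smul hb')
    simp only [map_add, map_smul, smul_eq_mul] at this
    have e1 : -e / d * φ b - -e / d * ψ b = -e := by
      rw [← mul_sub, ← hd, div_mul_cancel₀ _ hd0]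
    linarith

open Complex in
/-- Dual characterization of minimality: if `X` is anti-Hermitian of norm one and has minimal norm
modulo the anti-Hermitian part of the self-adjoint subspace `B`, then there is a state in whose
representation the cyclic vector `ξ` satisfies `X² ξ = -ξ` and `X ξ ⊥ B ξ`. -/
lemma exists_state_of_norm_le_norm_add {X : H →L[ℂ] H} (hX : star X = -X) (hn : ‖X‖ = 1)
    (B : Submodule ℂ (H →L[ℂ] H)) (hB : ∀ b ∈ B, star b ∈ B)
    (hmin : ∀ b ∈ B, star b = -b → 1 ≤ ‖X + b‖) :
    ∃ φ : (H →L[ℂ] H) →L[ℝ] ℝ, IsPositiveFunctional φ ∧ φ 1 = 1 ∧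
      (∀ c, φ (c * (X * X)) = -φ c) ∧ ∀ b ∈ B, φ (b * X) = 0 := by
  set h : H →L[ℂ] H := (-I) • X with hdef
  have hh : IsSelfAdjoint h := by
    rw [IsSelfAdjoint, hdef, star_smul, hX]; simp
  have hXh : X = I • h := by rw [hdef, smul_smul]; simp
  have hn' : ‖h‖ = 1 := by rw [hdef, norm_smul]; simp [hn]
  obtain ⟨φ, ψ, hφ, hψ, h1, hle, hb⟩ := exists_isPositiveFunctional_pair hh B (by
    intro b hb hb'
    have := hmin (I • b) (B.smul_mem _ hb) (by simp [star_smul, hb'.star_eq])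
    rw [hXh, ← smul_add, norm_smul] at this
    simpa using this)
  have hl1 := hφ.apply_le_norm_mul h
  have hl2 := hψ.apply_le_norm_mul (-h)
  rw [norm_neg, map_neg, hn', one_mul] at hl2
  rw [hn', one_mul] at hl1
  -- Since `1 ≤ φ h - ψ h ≤ φ 1 + ψ 1 = 1`, both functionals attain their norms. So `h` acts as `1`
  -- for `φ` and as `-1` for `ψ`, and `h²` acts as `1` for both.
  have hφm := hφ.apply_mul_of_apply_eq hh hn'.le (by linarith)
  have hψm : ∀ c, ψ (c * h) = -ψ c := fun c => by
    have := hψ.apply_mul_of_apply_eq hh.neg (by rw [norm_neg, hn']) (by rw [map_neg]; linarith) c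
    rw [mul_neg, map_neg] at this
    linarith
  have hBeq : ∀ b ∈ B, φ b = ψ b := by
    intro b hbB
    have h2 := hb (b + star b) (B.add_mem hbB (hB b hbB)) (by
      rw [IsSelfAdjoint, star_add, star_star, add_comm])
    rw [map_add, map_add, hφ.apply_star, hψ.apply_star] at h2
    linarith
  refine ⟨φ + ψ, fun a ha => add_nonneg (hφ a ha) (hψ a ha), h1, fun c => ?_, fun b hbB => ?_⟩
  · have e : c * (X * X) = -(c * h * h) := by
      rw [hXh, smul_mul_smul_comm, I_mul_I, mul_assoc]; simp
    simp only [e, map_neg, add_apply, hφm, hψm]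
    ring
  -- The opposite signs turn the sum at `b * X` into the difference `φ - ψ` at `I • b`, which
  -- vanishes on `B`.
  · have e : b * X = (I • b) * h := by rw [hXh]; simp
    simp only [e, add_apply, hφm, hψm, hBeq _ (B.smul_mem I hbB)]
    ring

end canonicalSphereBundle

/-! ### Polar decomposition and local cross sections of the action -/

namespace canonicalSphereBundle

variable {H : Type*} [NormedAddCommGroup H] [InnerProductSpace ℂ H]

/-- Positivity of `s` makes `s + 1` bounded below by one. With `(s + 1) (s - 1) = s² - 1`, this
transfers estimates from `s²` to `s`. -/
lemma norm_le_norm_add_one_apply {s : H →L[ℂ] H} (hs : 0 ≤ s) (x : H) :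
    ‖x‖ ≤ ‖(s + 1) x‖ := by
  have hp := ((ContinuousLinearMap.nonneg_iff_isPositive s).1 hs).re_inner_nonneg_left x
  have h1 : ‖x‖ ^ 2 ≤ RCLike.re (inner ℂ ((s + 1) x) x) := by
    simp only [add_apply, one_apply_eq_self, inner_add_left, map_add,
      inner_self_eq_norm_sq]
    linarith
  have h2 := (h1.trans (RCLike.re_le_norm _)).trans (norm_inner_le_norm _ _)
  rcases (norm_nonneg x).eq_or_lt with h | h
  · rw [← h]; positivity
  · exact le_of_mul_le_mul_right (by linarith [sq ‖x‖]) h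

variable [CompleteSpace H]

/-- The unitary part of the polar decomposition of an invertible operator, with its
intertwining properties and a bound on its distance to the identity. -/
lemma exists_unitary_of_isUnit {W P Q : H →L[ℂ] H} {f g : H} (hW : IsUnit W)
    (hP : IsSelfAdjoint P) (hQ : IsSelfAdjoint Q) (hWP : W * P = Q * W) (hWf : W f = g)
    (hf : (star W * W) f = f) :
    ∃ r ∈ unitary (H →L[ℂ] H), r * P = Q * r ∧ r f = g ∧ ‖r - 1‖ ≤ ‖W - 1‖ + ‖star W * W - 1‖ := by
  set s := CFC.abs W with hs
  have hs0 : 0 ≤ s := CFC.abs_nonneg W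
  have hss : s * s = star W * W := CFC.abs_mul_abs W
  have hsa : star s = s := hs0.isSelfAdjoint.star_eq
  have hsu : IsUnit s := isUnit_mul_self_iff.1 (hss ▸ hW.star.mul hW)
  have hfac : (s + 1) * (s - 1) = star W * W - 1 := by rw [← hss]; noncomm_ring
  have hsf : s f = f := by
    have h := norm_le_norm_add_one_apply hs0 ((s - 1) f)
    have : (s + 1) ((s - 1) f) = 0 := by
      rw [← mul_apply_eq_comp, hfac]; simp [hf]
    rw [this, norm_zero] at h
    simpa [sub_eq_zero] using h
  have hsn : ‖s - 1‖ ≤ ‖star W * W - 1‖ := by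
    refine ContinuousLinearMap.opNorm_le_bound _ (norm_nonneg _) fun x => ?_
    refine (norm_le_norm_add_one_apply hs0 _).trans ?_
    rw [← mul_apply_eq_comp, hfac]
    exact ContinuousLinearMap.le_opNorm _ _
  have hcomm : s * P = P * s := by
    have h1 : star W * Q = P * star W := by
      have := congrArg star hWP
      rwa [star_mul, star_mul, hP.star_eq, hQ.star_eq, eq_comm] at this
    have h2 : Commute (star W * W) P := by
      rw [Commute, SemiconjBy, mul_assoc, hWP, ← mul_assoc, h1, mul_assoc]
    exact (h2.cfcₙ_nnreal NNReal.sqrt).eq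
  obtain ⟨u, hu⟩ := hsu
  set r := W * ↑u⁻¹ with hr
  have hrs : r * s = W := by rw [hr, mul_assoc, ← hu, Units.inv_mul, mul_one]
  have hru : star r * r = 1 := by
    have h1 : star (↑u⁻¹ : H →L[ℂ] H) = ↑u⁻¹ := by
      have : star u = u := Units.ext (by rw [Units.coe_star, hu, hsa])
      rw [← Units.coe_star, star_inv, this]
    have h2 : star W * W = ↑u * ↑u := by rw [hu, hss]
    calc star r * r = ↑u⁻¹ * (star W * W) * ↑u⁻¹ := by rw [hr, star_mul, h1]; noncomm_ring
      _ = (↑u⁻¹ * ↑u) * (↑u * ↑u⁻¹) := by rw [h2]; noncomm_ring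
      _ = 1 := by simp
  have hrU : IsUnit r := hW.mul (Units.isUnit _)
  have hr' : r ∈ unitary (H →L[ℂ] H) := by
    refine Unitary.mem_iff.2 ⟨hru, ?_⟩
    obtain ⟨v, hv⟩ := hrU
    have : star r = ↑v⁻¹ := by
      rw [← hv] at hru ⊢
      exact Units.eq_inv_of_mul_eq_one_right hru
    rw [this, ← hv, Units.mul_inv]
  refine ⟨r, hr', ?_, ?_, ?_⟩
  · have : r * P * s = Q * r * s := by
      rw [mul_assoc, ← hcomm, ← mul_assoc, hrs, hWP, mul_assoc, hrs]
    rw [← hu] at this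
    exact (Units.mul_left_inj u).1 this
  · rw [← hWf, ← hrs, mul_apply_eq_comp r s, hsf]
  · have : r - 1 = (W - 1) - r * (s - 1) := by rw [mul_sub, hrs, mul_one]; abel
    rw [this]
    refine (norm_sub_le _ _).trans ?_
    rw [CStarRing.norm_mem_unitary_mul _ hr']
    gcongr

lemma norm_le_one_of_isStarProjection {P : H →L[ℂ] H} (hP : IsStarProjection P) : ‖P‖ ≤ 1 := by
  have h := CStarRing.norm_star_mul_self (x := P)
  rw [hP.isSelfAdjoint.star_eq, hP.isIdempotentElem.eq] at h
  rcases (norm_nonneg P).eq_or_lt with h0 | h0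
  · rw [← h0]; exact zero_le_one
  · exact (mul_right_cancel₀ h0.ne' (by linarith)).le

open InnerProductSpace in
/-- Local cross sections of the action of the unitary group on the sphere bundle, with a
Lipschitz bound. -/
lemma exists_unitary_of_norm_sub_le {p q : (H →L[ℂ] H) × H} (hp : p ∈ canonicalSphereBundle H)
    (hq : q ∈ canonicalSphereBundle H) (hpq : ‖p - q‖ ≤ 1 / 10) :
    ∃ r ∈ unitary (H →L[ℂ] H), r * p.1 = q.1 * r ∧ r p.2 = q.2 ∧ ‖r - 1‖ ≤ 20 * ‖p - q‖ := by
  obtain ⟨P, f⟩ := p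
  obtain ⟨Q, g⟩ := q
  obtain ⟨hP, hPf, hf⟩ := hp
  obtain ⟨hQ, hQg, hg⟩ := hq
  dsimp only at hP hPf hf hQ hQg hg ⊢
  set δ := ‖((P, f) : (H →L[ℂ] H) × H) - (Q, g)‖ with hδ
  have hδ1 : ‖P - Q‖ ≤ δ := norm_fst_le (((P, f) : (H →L[ℂ] H) × H) - (Q, g))
  have hδ2 : ‖f - g‖ ≤ δ := norm_snd_le (((P, f) : (H →L[ℂ] H) × H) - (Q, g))
  have hδ0 : 0 ≤ δ := norm_nonneg _
  have hPP := hP.isIdempotentElem.eq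
  have hQQ := hQ.isIdempotentElem.eq
  have hPs := hP.isSelfAdjoint.star_eq
  have hQs := hQ.isSelfAdjoint.star_eq
  set E : H →L[ℂ] H := rankOne ℂ f f with hE
  set F : H →L[ℂ] H := rankOne ℂ g g with hF
  set R : H →L[ℂ] H := rankOne ℂ g f with hR
  have rk : ∀ (A : H →L[ℂ] H) (x y : H), A * rankOne ℂ x y = rankOne ℂ (A x) y :=
    fun A x y => comp_rankOne x y A
  have kr : ∀ (A : H →L[ℂ] H) (x y : H), rankOne ℂ x y * A = rankOne ℂ x (star A y) :=
    fun A x y => rankOne_comp x y A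
  have hEE : E * E = E := by rw [hE, rk]; simp [hf]
  have hFF : F * F = F := by rw [hF, rk]; simp [hg]
  have hPE : P * E = E := by rw [hE, rk, hPf]
  have hEP : E * P = E := by rw [hE, kr, hPs, hPf]
  have hQF : Q * F = F := by rw [hF, rk, hQg]
  have hFQ : F * Q = F := by rw [hF, kr, hQs, hQg]
  have hRE : R * E = R := by rw [hE, hR, rk]; simp [hf]
  have hFR : F * R = R := by rw [hF, hR, rk]; simp [hg]
  have hQR : Q * R = R := by rw [hR, rk, hQg]
  have hRP : R * P = R := by rw [hR, kr, hPs, hPf]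
  have hEs : star E = E := by rw [ContinuousLinearMap.star_eq_adjoint, hE, adjoint_rankOne]
  have hFs : star F = F := by rw [ContinuousLinearMap.star_eq_adjoint, hF, adjoint_rankOne]
  have hEf : E f = f := by simp [hE, hf]
  have hRf : R f = g := by simp [hR, hf]
  -- Blockwise intertwiner: the line of `f` goes to that of `g`, the rest of the range of `P` is
  -- compressed to the rest of the range of `Q`, and likewise for the complements. For `p = q` it is
  -- `1`.
  set W : H →L[ℂ] H := R + (Q - F) * (P - E) + (1 - Q) * (1 - P) with hWdef
  have hWf : W f = g := by
    simp [hWdef, hRf, hPf, hEf]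
  have hWg : star W g = f := by
    have hRg : star R g = f := by
      rw [ContinuousLinearMap.star_eq_adjoint, hR, adjoint_rankOne]; simp [hg]
    have hFg : F g = g := by simp [hF, hg]
    have : star W = star R + (P - E) * (Q - F) + (1 - P) * (1 - Q) := by
      simp only [hWdef, star_add, star_mul, star_sub, star_one, hPs, hQs, hEs, hFs]
    simp [this, hRg, hFg, hQg]
  have hWP : W * P = Q * W := by
    have h1 : W * P = R + (Q - F) * (P - E) := by
      rw [hWdef, add_mul, add_mul, hRP, mul_assoc, mul_assoc, sub_mul P E P, hEP, hPP,
        sub_mul 1 P P, hPP, one_mul, sub_self, mul_zero, add_zero]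
    have h2 : Q * W = R + (Q - F) * (P - E) := by
      rw [hWdef, mul_add, mul_add, hQR, ← mul_assoc, ← mul_assoc, mul_sub Q Q F, hQF, hQQ,
        mul_sub Q 1 Q, hQQ, mul_one, sub_self, zero_mul, add_zero]
    rw [h1, h2]
  have hPEn : ‖P - E‖ ≤ 1 := norm_le_one_of_isStarProjection
    ⟨by simp only [IsIdempotentElem, mul_sub, sub_mul, hPP, hPE, hEP, hEE]; abel,
      by rw [IsSelfAdjoint, star_sub, hPs, hEs]⟩
  have hPn : ‖1 - P‖ ≤ 1 := norm_le_one_of_isStarProjection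
    ⟨by simp only [IsIdempotentElem, mul_sub, sub_mul, hPP, one_mul, mul_one]; abel,
      by rw [IsSelfAdjoint, star_sub, hPs, star_one]⟩
  have hREn : ‖R - E‖ ≤ δ := by
    rw [show R - E = rankOne ℂ (g - f) f by simp [hR, hE], norm_rankOne, hf, mul_one, norm_sub_rev]
    exact hδ2
  have hRFn : ‖F - R‖ ≤ δ := by
    rw [show F - R = rankOne ℂ g (g - f) by simp [hR, hF], norm_rankOne, hg, one_mul, norm_sub_rev]
    exact hδ2
  have hW1 : ‖W - 1‖ ≤ 5 * δ := by
    have e : W - 1 = (R - E) + ((Q - P) - ((F - R) + (R - E))) * (P - E) + (P - Q) * (1 - P) := by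
      have e1 : (1 : H →L[ℂ] H) = E + (P - E) * (P - E) + (1 - P) * (1 - P) := by
        simp only [mul_sub, sub_mul, hPP, hPE, hEP, hEE, one_mul, mul_one]; abel
      nth_rw 1 [e1]
      rw [hWdef]
      noncomm_ring
    have hQP : ‖Q - P‖ ≤ δ := by rwa [norm_sub_rev]
    have h3 : ‖(Q - P) - ((F - R) + (R - E))‖ ≤ δ + (δ + δ) :=
      norm_sub_le_of_le hQP (norm_add_le_of_le hRFn hREn)
    have h4 := (norm_mul_le ((Q - P) - ((F - R) + (R - E))) (P - E)).trans
      (mul_le_mul h3 hPEn (norm_nonneg _) (by positivity))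
    have h5 := (norm_mul_le (P - Q) (1 - P)).trans (mul_le_mul hδ1 hPn (norm_nonneg _) hδ0)
    rw [e]
    refine (norm_add_le_of_le (norm_add_le_of_le hREn h4) h5).trans ?_
    linarith
  have hWu : IsUnit W := by
    have := isUnit_one_sub_of_norm_lt_one (x := 1 - W) (by rw [norm_sub_rev]; linarith)
    simpa using this
  obtain ⟨r, hr, h1, h2, h3⟩ := exists_unitary_of_isUnit hWu hP.isSelfAdjoint hQ.isSelfAdjoint hWP
    hWf (by rw [mul_apply_eq_comp, hWf, hWg])
  refine ⟨r, hr, h1, h2, h3.trans ?_⟩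
  have h4 : ‖star W * W - 1‖ ≤ ‖W - 1‖ * ‖W - 1‖ + (‖W - 1‖ + ‖W - 1‖) := by
    have e : star W * W - 1 = star (W - 1) * (W - 1) + (star (W - 1) + (W - 1)) := by
      simp only [star_sub, star_one]; noncomm_ring
    rw [e]
    refine norm_add_le_of_le ((norm_mul_le _ _).trans_eq (by rw [norm_star])) ?_
    exact norm_add_le_of_le (by rw [norm_star]) le_rfl
  -- The total is at most `15 δ + 25 δ²`, below `20 δ` because `δ ≤ 1 / 10`.
  nlinarith [norm_nonneg (W - 1)]

end canonicalSphereBundle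

/-! ### Angles and chords on the unit sphere -/

lemma Real.arccos_le_arccos_add_arccos {p q r : ℝ} (hp : p ∈ Set.Icc (-1) 1)
    (hq : q ∈ Set.Icc (-1) 1) (h : (r - p * q) ^ 2 ≤ (1 - p ^ 2) * (1 - q ^ 2)) :
    Real.arccos r ≤ Real.arccos p + Real.arccos q := by
  rcases le_total (Real.arccos p + Real.arccos q) Real.pi with hle | hle
  · have hcos : Real.cos (Real.arccos p + Real.arccos q) ≤ r := by
      rw [Real.cos_add, Real.cos_arccos hp.1 hp.2, Real.cos_arccos hq.1 hq.2, Real.sin_arccos,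
        Real.sin_arccos, ← Real.sqrt_mul' _ (by nlinarith [hq.1, hq.2])]
      have := neg_le_of_abs_le (Real.abs_le_sqrt h)
      linarith
    rw [← Real.arccos_cos (add_nonneg (Real.arccos_nonneg p) (Real.arccos_nonneg q)) hle]
    exact Real.arccos_le_arccos hcos
  · exact (Real.arccos_le_pi r).trans hle

lemma Real.arccos_one_sub_sq_div_two {x : ℝ} (h0 : 0 ≤ x) (h2 : x ≤ 2) :
    Real.arccos (1 - x ^ 2 / 2) = 2 * Real.arcsin (x / 2) := by
  have h1 : 0 ≤ Real.arcsin (x / 2) := Real.arcsin_nonneg.2 (by linarith)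
  have h3 := Real.arcsin_le_pi_div_two (x / 2)
  rw [← Real.arccos_cos (x := 2 * Real.arcsin (x / 2)) (by linarith) (by linarith),
    Real.cos_two_mul, Real.cos_sq', Real.sin_arcsin (by linarith) (by linarith)]
  ring_nf

/-- Jordan's inequality. This crude constant serves only for Lipschitz continuity; the sharp speed
bound needs the next lemma, whose constant is arbitrarily close to one. -/
lemma Real.arccos_one_sub_sq_div_two_le {x : ℝ} (h0 : 0 ≤ x) (h2 : x ≤ 2) :
    Real.arccos (1 - x ^ 2 / 2) ≤ Real.pi / 2 * x := by
  rw [Real.arccos_one_sub_sq_div_two h0 h2]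
  have h1 : 0 ≤ Real.arcsin (x / 2) := Real.arcsin_nonneg.2 (by linarith)
  have h3 := Real.mul_le_sin h1 (Real.arcsin_le_pi_div_two (x / 2))
  rw [Real.sin_arcsin (by linarith) (by linarith), div_mul_eq_mul_div,
    div_le_iff₀ Real.pi_pos] at h3
  linarith

lemma Real.eventually_arccos_one_sub_sq_div_two_le {c : ℝ} (hc : 1 < c) :
    ∃ δ > 0, ∀ x, 0 ≤ x → x < δ → Real.arccos (1 - x ^ 2 / 2) ≤ c * x := by
  have hd : HasDerivAt (fun x : ℝ => 2 * Real.arcsin (x / 2)) 1 0 := by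
    have h1 : HasDerivAt Real.arcsin 1 (0 / 2) := by
      simpa using Real.hasDerivAt_arcsin (x := 0) (by norm_num) (by norm_num)
    have h2 := (h1.comp (0 : ℝ) ((hasDerivAt_id (0 : ℝ)).div_const 2)).const_mul 2
    simpa [Function.comp_def] using h2
  have h := hd.isLittleO.def (sub_pos.2 hc)
  obtain ⟨δ, hδ, hball⟩ := Metric.eventually_nhds_iff.1 h
  refine ⟨min δ 2, by positivity, fun x hx0 hx => ?_⟩
  have := hball (y := x) (by
    rw [Real.dist_eq, sub_zero, abs_of_nonneg hx0]; exact hx.trans_le (min_le_left _ _))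
  rw [Real.arccos_one_sub_sq_div_two hx0 (hx.le.trans (min_le_right _ _))]
  simp only [zero_div, Real.arcsin_zero, mul_zero, sub_zero, smul_eq_mul, mul_one, Real.norm_eq_abs,
    abs_of_nonneg hx0] at this
  have := (le_abs_self _).trans this
  linarith

/-! ### The angle function on the orbit -/

namespace canonicalSphereBundle

variable {H : Type*} [NormedAddCommGroup H] [InnerProductSpace ℂ H] [CompleteSpace H]

namespace IsPositiveFunctional

variable {φ : (H →L[ℂ] H) →L[ℝ] ℝ}

/-- The spherical triangle inequality for unit vectors in the representation given by `φ`. -/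
lemma arccos_le_add (hφ : IsPositiveFunctional φ) {a b c : H →L[ℂ] H} (ha : φ (star a * a) = 1)
    (hb : φ (star b * b) = 1) (hc : φ (star c * c) = 1) :
    Real.arccos (φ (star a * c)) ≤
      Real.arccos (φ (star a * b)) + Real.arccos (φ (star b * c)) := by
  have hab := hφ.apply_star_mul_sq_le a b
  have hbc := hφ.apply_star_mul_sq_le b c
  rw [ha, hb, one_mul] at hab
  rw [hb, hc, one_mul] at hbc
  set p := φ (star a * b) with hp
  set q := φ (star b * c) with hq
  refine Real.arccos_le_arccos_add_arccos (abs_le.1 (sq_le_one_iff_abs_le_one _ |>.1 hab))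
    (abs_le.1 (sq_le_one_iff_abs_le_one _ |>.1 hbc)) ?_
  -- Cauchy–Schwarz for the components of `a` and `c` orthogonal to `b` is exactly the Gram
  -- condition required.
  have key := hφ.apply_star_mul_sq_le (a - p • b) (c - q • b)
  have e : ∀ (x y : H →L[ℂ] H) (s t : ℝ), φ (star (x - s • b) * (y - t • b))
      = φ (star x * y) - t * φ (star x * b) - s * φ (star b * y) + s * t * φ (star b * b) := by
    intro x y s t
    simp only [star_sub, star_smul, star_trivial, sub_mul, mul_sub, smul_mul_assoc,
      mul_smul_comm, map_sub, map_smul, smul_eq_mul]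
    ring
  rw [e, e, e, ha, hb, hc, hφ.apply_star_mul_comm b a, hφ.apply_star_mul_comm c b, ← hp,
    ← hq] at key
  convert key using 1 <;> ring

lemma apply_star_mul_self_of_mem_unitary (h1 : φ 1 = 1) {u : H →L[ℂ] H}
    (hu : u ∈ unitary (H →L[ℂ] H)) : φ (star u * u) = 1 := by
  rw [Unitary.star_mul_self_of_mem hu, h1]

/-- The unit vectors `r u ξ` and `u ξ` are at distance at most `‖r * u - u‖ = ‖r - 1‖`; the right
side is the angle subtended by a chord of that length. -/
lemma arccos_star_mul_mul_le (hφ : IsPositiveFunctional φ) (h1 : φ 1 = 1) {u r : H →L[ℂ] H}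
    (hu : u ∈ unitary (H →L[ℂ] H)) (hr : r ∈ unitary (H →L[ℂ] H)) :
    Real.arccos (φ (star (r * u) * u)) ≤ Real.arccos (1 - ‖r - 1‖ ^ 2 / 2) := by
  refine Real.arccos_le_arccos ?_
  have e : star (r * u - u) * (r * u - u) = star (r * u) * (r * u) + star u * u
      - star (r * u) * u - star u * (r * u) := by
    simp only [star_sub]; noncomm_ring
  have h2 := hφ.apply_le_norm_mul (star (r * u - u) * (r * u - u))
  rw [e, map_sub, map_sub, map_add, apply_star_mul_self_of_mem_unitary h1 hu,
    apply_star_mul_self_of_mem_unitary h1 (mul_mem hr hu), hφ.apply_star_mul_comm u, ← e,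
    CStarRing.norm_star_mul_self, show r * u - u = (r - 1) * u by rw [sub_mul, one_mul],
    CStarRing.norm_mul_mem_unitary _ hu, h1] at h2
  linarith

end IsPositiveFunctional

/-- The unitary operators that move the point `p` of the sphere bundle to `q`. -/
def transporters (p q : (H →L[ℂ] H) × H) : Set (H →L[ℂ] H) :=
  {u | u ∈ unitary (H →L[ℂ] H) ∧ u * p.1 = q.1 * u ∧ u p.2 = q.2}

lemma mul_mem_transporters {p q q' : (H →L[ℂ] H) × H} {u r : H →L[ℂ] H}
    (hr : r ∈ transporters q q') (hu : u ∈ transporters p q) : r * u ∈ transporters p q' := by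
  refine ⟨mul_mem hr.1 hu.1, ?_, ?_⟩
  · rw [mul_assoc, hu.2.1, ← mul_assoc, hr.2.1, mul_assoc]
  · rw [mul_apply_eq_comp, hu.2.2, hr.2.2]

lemma star_mem_transporters {p q : (H →L[ℂ] H) × H} {u : H →L[ℂ] H}
    (hu : u ∈ transporters p q) : star u ∈ transporters q p := by
  obtain ⟨hu, h1, h2⟩ := hu
  have hl := Unitary.star_mul_self_of_mem hu
  have hr := Unitary.mul_star_self_of_mem hu
  refine ⟨Unitary.star_mem hu, ?_, ?_⟩
  · calc star u * q.1 = star u * (q.1 * u) * star u := by rw [mul_assoc, mul_assoc, hr, mul_one]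
      _ = (star u * u) * p.1 * star u := by rw [← h1, mul_assoc (star u) u]
      _ = p.1 * star u := by rw [hl, one_mul]
  · rw [← h2, ← mul_apply_eq_comp, hl, one_apply_eq_self]

/-- The angle, in the representation given by `φ`, between the unit vector given by `w` and the
set of unit vectors associated with the point `q` of the orbit of `p`. -/
noncomputable def orbitAngle (φ : (H →L[ℂ] H) →L[ℝ] ℝ) (p : (H →L[ℂ] H) × H) (w : H →L[ℂ] H)
    (q : (H →L[ℂ] H) × H) : ℝ :=
  sInf ((fun u => Real.arccos (φ (star u * w))) '' transporters p q)

section orbitAngle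

variable {φ : (H →L[ℂ] H) →L[ℝ] ℝ} {p q q' : (H →L[ℂ] H) × H} {w r : H →L[ℂ] H}

lemma bddBelow_arccos_image (S : Set (H →L[ℂ] H)) :
    BddBelow ((fun u => Real.arccos (φ (star u * w))) '' S) :=
  ⟨0, by rintro _ ⟨u, -, rfl⟩; exact Real.arccos_nonneg _⟩

lemma orbitAngle_le {u : H →L[ℂ] H} (hu : u ∈ transporters p q) :
    orbitAngle φ p w q ≤ Real.arccos (φ (star u * w)) :=
  csInf_le (bddBelow_arccos_image _) ⟨u, hu, rfl⟩

lemma orbitAngle_nonneg : 0 ≤ orbitAngle φ p w q :=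
  Real.sInf_nonneg (by rintro _ ⟨u, -, rfl⟩; exact Real.arccos_nonneg _)

lemma orbitAngle_le_pi : orbitAngle φ p w q ≤ Real.pi := by
  rcases (transporters p q).eq_empty_or_nonempty with h | ⟨u, hu⟩
  · rw [orbitAngle, h, Set.image_empty, Real.sInf_empty]; exact Real.pi_pos.le
  · exact (orbitAngle_le hu).trans (Real.arccos_le_pi _)

/-- Left multiplication by `r` carries competitors for `q` to competitors for `q'`, turning each
vector by a controlled angle. -/
lemma orbitAngle_le_add (hφ : IsPositiveFunctional φ) (h1 : φ 1 = 1)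
    (hw : w ∈ unitary (H →L[ℂ] H)) (hr : r ∈ transporters q q') :
    orbitAngle φ p w q' ≤ orbitAngle φ p w q + Real.arccos (1 - ‖r - 1‖ ^ 2 / 2) := by
  rcases (transporters p q).eq_empty_or_nonempty with h | hne
  · have h' : transporters p q' = ∅ := by
      rw [Set.eq_empty_iff_forall_notMem] at h ⊢
      exact fun u hu => h _ (mul_mem_transporters (star_mem_transporters hr) hu)
    rw [orbitAngle, orbitAngle, h, h', Set.image_empty, Real.sInf_empty, zero_add]
    exact Real.arccos_nonneg _
  · rw [← sub_le_iff_le_add]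
    refine le_csInf (hne.image _) ?_
    rintro _ ⟨u, hu, rfl⟩
    have h2 := orbitAngle_le (φ := φ) (w := w) (mul_mem_transporters hr hu)
    have h3 := hφ.arccos_le_add (b := u)
      (IsPositiveFunctional.apply_star_mul_self_of_mem_unitary h1 (mul_mem hr.1 hu.1))
      (IsPositiveFunctional.apply_star_mul_self_of_mem_unitary h1 hu.1)
      (IsPositiveFunctional.apply_star_mul_self_of_mem_unitary h1 hw)
    have h4 := hφ.arccos_star_mul_mul_le h1 hu.1 hr.1
    linarith

lemma abs_orbitAngle_sub_le (hφ : IsPositiveFunctional φ) (h1 : φ 1 = 1)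
    (hw : w ∈ unitary (H →L[ℂ] H)) (hr : r ∈ transporters q q') :
    |orbitAngle φ p w q' - orbitAngle φ p w q| ≤ Real.arccos (1 - ‖r - 1‖ ^ 2 / 2) := by
  have h2 := orbitAngle_le_add (p := p) hφ h1 hw hr
  have h3 := orbitAngle_le_add (p := p) hφ h1 hw (star_mem_transporters hr)
  have : ‖star r - 1‖ = ‖r - 1‖ := by rw [← norm_star, star_sub, star_star, star_one]
  rw [this] at h3
  rw [abs_le]
  constructor <;> linarith

/-- Needed only for absolute continuity along curves. The constant is `π / 2` times the `20` of the
cross sections; for points at least `1 / 10` apart it exceeds the trivial bound `π`. -/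
lemma abs_orbitAngle_sub_le_mul_norm (hφ : IsPositiveFunctional φ) (h1 : φ 1 = 1)
    (hw : w ∈ unitary (H →L[ℂ] H)) (hq : q ∈ canonicalSphereBundle H)
    (hq' : q' ∈ canonicalSphereBundle H) :
    |orbitAngle φ p w q' - orbitAngle φ p w q| ≤ 10 * Real.pi * ‖q' - q‖ := by
  have hpi := Real.pi_pos
  rw [norm_sub_rev]
  rcases le_total ‖q - q'‖ (1 / 10) with h | h
  · obtain ⟨r, hr, h2, h3, h4⟩ := exists_unitary_of_norm_sub_le hq hq' h
    refine (abs_orbitAngle_sub_le hφ h1 hw ⟨hr, h2, h3⟩).trans ?_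
    refine (Real.arccos_one_sub_sq_div_two_le (norm_nonneg _) (by linarith)).trans ?_
    calc Real.pi / 2 * ‖r - 1‖ ≤ Real.pi / 2 * (20 * ‖q - q'‖) := by gcongr
      _ = _ := by ring
  · have h2 := orbitAngle_nonneg (φ := φ) (p := p) (w := w) (q := q)
    have h3 := orbitAngle_nonneg (φ := φ) (p := p) (w := w) (q := q')
    have h4 := orbitAngle_le_pi (φ := φ) (p := p) (w := w) (q := q)
    have h5 := orbitAngle_le_pi (φ := φ) (p := p) (w := w) (q := q')
    rw [abs_le]
    constructor <;> nlinarith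

end orbitAngle

end canonicalSphereBundle

/-! ### Exponential curves and liftings of velocities -/

namespace canonicalSphereBundle

variable {H : Type*} [NormedAddCommGroup H] [InnerProductSpace ℂ H] [CompleteSpace H]

section expCurve

variable {X : H →L[ℂ] H} {p : (H →L[ℂ] H) × H}

lemma exp_real_smul_mem_unitary (hX : X ∈ skewAdjoint (H →L[ℂ] H)) (t : ℝ) :
    NormedSpace.exp (t • X) ∈ unitary (H →L[ℂ] H) := by
  let _ : NormedAlgebra ℚ (H →L[ℂ] H) := NormedAlgebra.restrictScalars ℚ ℂ _
  exact NormedSpace.exp_mem_unitary_of_mem_skewAdjoint (skewAdjoint.smul_mem t hX)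

lemma exp_neg_real_smul (hX : X ∈ skewAdjoint (H →L[ℂ] H)) (t : ℝ) :
    NormedSpace.exp (-(t • X)) = star (NormedSpace.exp (t • X)) := by
  let _ : NormedAlgebra ℚ (H →L[ℂ] H) := NormedAlgebra.restrictScalars ℚ ℂ _
  rw [NormedSpace.star_exp, star_smul, star_trivial, skewAdjoint.mem_iff.1 hX, smul_neg]

lemma exp_mem_transporters (hX : X ∈ skewAdjoint (H →L[ℂ] H)) (t : ℝ) :
    NormedSpace.exp (t • X) ∈ transporters p (expCurve p X t) := by
  have hu := exp_real_smul_mem_unitary hX t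
  refine ⟨hu, ?_, rfl⟩
  rw [expCurve, exp_neg_real_smul hX, mul_assoc, Unitary.star_mul_self_of_mem hu, mul_one]

lemma mem_of_mem_transporters {q : (H →L[ℂ] H) × H} {u : H →L[ℂ] H}
    (hp : p ∈ canonicalSphereBundle H) (hu : u ∈ transporters p q) :
    q ∈ canonicalSphereBundle H := by
  obtain ⟨⟨hP, hPs⟩, hPf, hf⟩ := hp
  obtain ⟨hu, h1, h2⟩ := hu
  have hl := Unitary.star_mul_self_of_mem hu
  have hr := Unitary.mul_star_self_of_mem hu
  have hq : q.1 = u * p.1 * star u := by rw [h1, mul_assoc, hr, mul_one]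
  refine ⟨⟨?_, ?_⟩, ?_, ?_⟩
  · calc q.1 * q.1 = u * p.1 * (star u * u) * p.1 * star u := by rw [hq]; simp only [mul_assoc]
      _ = u * (p.1 * p.1) * star u := by rw [hl, mul_one, mul_assoc u]
      _ = q.1 := by rw [hP.eq, hq]
  · rw [IsSelfAdjoint, hq, star_mul, star_mul, star_star, hPs.star_eq, mul_assoc]
  · rw [← h2, ← mul_apply_eq_comp, ← h1, mul_apply_eq_comp, hPf]
  · have : ‖u p.2‖ ^ 2 = ‖p.2‖ ^ 2 := by
      rw [← reApplyInnerSelf_star_mul_self, hl, reApplyInnerSelf_one]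
    rw [← h2, ← hf]
    exact (sq_eq_sq₀ (norm_nonneg _) (norm_nonneg _)).1 this

lemma expCurve_mem (hp : p ∈ canonicalSphereBundle H) (hX : X ∈ skewAdjoint (H →L[ℂ] H)) (t : ℝ) :
    expCurve p X t ∈ canonicalSphereBundle H :=
  mem_of_mem_transporters hp (exp_mem_transporters hX t)

lemma expCurve_zero : expCurve p X 0 = p := by
  simp [expCurve]

lemma exp_add_real_smul (a t : ℝ) :
    NormedSpace.exp ((a + t) • X) = NormedSpace.exp (t • X) * NormedSpace.exp (a • X) := by
  let _ : NormedAlgebra ℚ (H →L[ℂ] H) := NormedAlgebra.restrictScalars ℚ ℂ _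
  rw [add_comm a, add_smul]
  exact NormedSpace.exp_add_of_commute (((Commute.refl X).smul_left _).smul_right _)

lemma expCurve_expCurve (a t : ℝ) :
    expCurve (expCurve p X a) X t = expCurve p X (a + t) := by
  have h := exp_add_real_smul (X := -X) t a
  simp only [smul_neg] at h
  simp only [expCurve, exp_add_real_smul, add_comm a t ▸ h, mul_assoc, mul_apply_eq_comp]

lemma contDiff_expCurve {n : ℕ∞} : ContDiff ℝ n (expCurve p X) := by
  have hexp : ∀ Y : H →L[ℂ] H, ContDiff ℝ n fun t : ℝ => NormedSpace.exp (t • Y) := fun Y => by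
    have h1 : ContDiff ℝ n (NormedSpace.exp : (H →L[ℂ] H) → (H →L[ℂ] H)) :=
      contDiff_iff_contDiffAt.2 fun x =>
        (NormedSpace.exp_analytic (𝕂 := ℝ) x).contDiffAt
    exact h1.comp (contDiff_id.smul contDiff_const)
  refine ContDiff.prodMk (((hexp X).mul contDiff_const).mul ?_) ?_
  · simpa using hexp (-X)
  · exact ((ContinuousLinearMap.apply ℂ H p.2).restrictScalars ℝ).contDiff.comp (hexp X)

lemma hasDerivAt_expCurve (t : ℝ) :
    HasDerivAt (expCurve p X) (infinitesimalAction (expCurve p X t) X) t := by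
  have h1 := hasDerivAt_exp_smul_const' (𝕂 := ℝ) X t
  have h2 := hasDerivAt_exp_smul_const (𝕂 := ℝ) (-X) t
  simp only [smul_neg] at h2
  have h3 := ((ContinuousLinearMap.apply ℂ H p.2).restrictScalars ℝ).hasFDerivAt.comp_hasDerivAt t h1
  have h4 := ((h1.mul_const p.1).mul h2).prodMk h3
  refine HasDerivAt.congr_deriv (f := expCurve p X) h4 ?_
  refine Prod.ext ?_ rfl
  simp only [infinitesimalAction, expCurve, LinearMap.coe_mk, AddHom.coe_mk]
  noncomm_ring

end expCurve

open InnerProductSpace in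
/-- The velocity of a curve in the sphere bundle is a tangent vector. -/
lemma exists_isLifting_of_hasDerivAt {η : ℝ → (H →L[ℂ] H) × H} {V : (H →L[ℂ] H) × H} {s : ℝ}
    (hd : HasDerivAt η V s) (hη : ∀ᶠ t in nhds s, η t ∈ canonicalSphereBundle H) :
    ∃ Y, IsLifting (η s) V Y := by
  obtain ⟨hP, hPf, hf⟩ := hη.self_of_nhds
  obtain ⟨A, v⟩ := V
  have hd1 : HasDerivAt (fun t => (η t).1) A s := hd.fst
  have hd2 : HasDerivAt (fun t => (η t).2) v s := hd.snd
  -- The equations `e1` to `e4` are the derivatives of `P² = P`, `P* = P`, `P f = f` and `⟨f, f⟩ =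
  -- 1`.
  have hPP := hP.isIdempotentElem.eq
  have hPs := hP.isSelfAdjoint.star_eq
  have e1 : A * (η s).1 + (η s).1 * A = A :=
    (hd1.mul hd1).unique (hd1.congr_of_eventuallyEq (hη.mono fun t ht => ht.1.isIdempotentElem.eq))
  have e2 : star A = A :=
    hd1.star.unique (hd1.congr_of_eventuallyEq
      (hη.mono fun t ht => ht.1.isSelfAdjoint.star_eq))
  have e3 : A (η s).2 + (η s).1 v = v := by
    have h1 : HasDerivAt (fun t => ((η t).1.restrictScalars ℝ)) (A.restrictScalars ℝ) s :=
      (ContinuousLinearMap.restrictScalarsL ℂ H H ℝ ℝ).hasFDerivAt.comp_hasDerivAt s hd1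
    exact (h1.clm_apply hd2).unique (hd2.congr_of_eventuallyEq (hη.mono fun t ht => ht.2.1))
  have e4 : inner ℂ (η s).2 v + inner ℂ v (η s).2 = 0 :=
    (hd2.inner ℂ hd2).unique ((hasDerivAt_const s (1 : ℂ)).congr_of_eventuallyEq
      (hη.mono fun t ht => by
        change inner ℂ (η t).2 (η t).2 = 1
        rw [inner_self_eq_norm_sq_to_K, ht.2.2]; simp))
  generalize (η s) = q at *
  obtain ⟨P, f⟩ := q
  dsimp only at *
  have hPAP : P * A * P = 0 := by
    have : P * A * P + P * A * P = P * A * P := by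
      have := congrArg (fun B => P * B * P) e1
      simp only [mul_add, add_mul] at this
      rwa [mul_assoc P (A * P) P, mul_assoc A P P, ← mul_assoc P P A, hPP, ← mul_assoc P A P] at this
    simpa using this
  set z := P v with hz
  have hPz : P z = z := by rw [hz, ← mul_apply_eq_comp, hPP]
  have hzf : inner ℂ z f = inner ℂ v f := by
    rw [hz, ← ContinuousLinearMap.adjoint_inner_right, ← ContinuousLinearMap.star_eq_adjoint, hPs,
      hPf]
  set c : ℂ := inner ℂ z f with hc
  have hcc : star c = -c := by
    have h : star (inner ℂ v f) = inner ℂ f v := inner_conj_symm f v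
    rw [hzf, h]
    linear_combination e4
  have rk : ∀ x y : H, P * rankOne ℂ x y = rankOne ℂ (P x) y := fun x y => comp_rankOne x y P
  have kr : ∀ x y : H, rankOne ℂ x y * P = rankOne ℂ x (P y) := fun x y => by
    have : rankOne ℂ x y * P = rankOne ℂ x (star P y) := rankOne_comp x y P
    rwa [hPs] at this
  -- The commutator `A * P - P * A` already lifts `A` but sends `f` to `A f`. The skew operator `Z`
  -- commutes with `P` and supplies the missing `P v`; the last term cancels the multiple of `f`
  -- left by the second.
  set Z : H →L[ℂ] H := rankOne ℂ z f - rankOne ℂ f z + c • rankOne ℂ f f with hZ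
  have hZs : star Z = -Z := by
    simp only [hZ, star_add, star_sub, star_smul, ContinuousLinearMap.star_eq_adjoint,
      adjoint_rankOne, hcc]
    module
  have hZP : Z * P = P * Z := by
    simp only [hZ, mul_add, mul_sub, add_mul, sub_mul, rk, kr, hPz, hPf, smul_mul_assoc,
      mul_smul_comm]
  have hZf : Z f = z := by
    simp [hZ, hf, ← hc]
  refine ⟨A * P - P * A + Z, ?_, ?_⟩
  · rw [skewAdjoint.mem_iff, star_add, star_sub, star_mul, star_mul, e2, hPs, hZs]; abel
  · have h1 : (A * P - P * A + Z) * P - P * (A * P - P * A + Z) = A := by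
      calc _ = A * (P * P) - 2 • (P * A * P) + P * P * A + (Z * P - P * Z) := by noncomm_ring
        _ = A := by rw [hPP, hPAP, hZP, sub_self, smul_zero, sub_zero, add_zero, e1]
    have h2 : (A * P - P * A + Z) f = v := by
      have h3 : P (A f) = 0 := by
        have := congrArg (fun B : H →L[ℂ] H => B f) hPAP
        simpa [hPf] using this
      simp only [add_apply, sub_apply, mul_apply_eq_comp, hPf, h3, hZf, sub_zero]
      exact e3
    exact Prod.ext h1 h2

lemma finslerNorm_le {p V : (H →L[ℂ] H) × H} {X : H →L[ℂ] H} (hX : IsLifting p V X) :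
    finslerNorm p V ≤ ‖X‖ :=
  csInf_le ⟨0, by rintro _ ⟨Y, -, rfl⟩; exact norm_nonneg Y⟩ ⟨X, hX, rfl⟩

/-! ### The angle changes no faster than the Finsler speed -/

section derivative

variable {φ : (H →L[ℂ] H) →L[ℝ] ℝ} {p : (H →L[ℂ] H) × H} {w : H →L[ℂ] H}

/-- Along a curve in the sphere bundle, nearby points are obtained by unitary operators whose
distance to the identity is controlled by the norm of a lifting of the velocity. -/
lemma eventually_exists_transporter {η : ℝ → (H →L[ℂ] H) × H} {V : (H →L[ℂ] H) × H} {s : ℝ}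
    {Y : H →L[ℂ] H} (hd : HasDerivAt η V s)
    (hη : ∀ᶠ t in nhds s, η t ∈ canonicalSphereBundle H) (hY : IsLifting (η s) V Y)
    {c : ℝ} (hc : ‖Y‖ < c) :
    ∀ᶠ t in nhds s, ∃ r ∈ transporters (η s) (η t), ‖r - 1‖ ≤ c * |t - s| := by
  have hs := hη.self_of_nhds
  have hexp : HasDerivAt (fun t : ℝ => NormedSpace.exp ((t - s) • Y)) Y s := by
    have h := hasDerivAt_exp_smul_const (𝕂 := ℝ) Y (s - s)
    simpa using HasDerivAt.comp_sub_const s s h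
  have hcurve : HasDerivAt (fun t : ℝ => expCurve (η s) Y (t - s)) V s := by
    have h := hasDerivAt_expCurve (p := η s) (X := Y) (s - s)
    rw [sub_self, expCurve_zero, hY.2] at h
    exact HasDerivAt.comp_sub_const s s (by rwa [sub_self])
  -- The curve deviates from the exponential curve by `ε |t - s|`, the cross section multiplies this
  -- by `20`, and the remainder of the exponential adds one more `ε`: `21 ε` in all.
  set ε := (c - ‖Y‖) / 40 with hε
  have hε0 : 0 < ε := by rw [hε]; linarith
  have h1 := (hd.sub hcurve).isLittleO.def hε0
  have h2 := hexp.isLittleO.def hε0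
  have h3 : ∀ᶠ t in nhds s, ε * |t - s| ≤ 1 / 10 := by
    have : ContinuousAt (fun t : ℝ => ε * |t - s|) s := by fun_prop
    exact (this.eventually_lt continuousAt_const (by simp)).mono fun t ht => ht.le
  filter_upwards [h1, h2, h3, hη] with t h1 h2 h3 ht
  simp only [Pi.sub_apply, sub_self, expCurve_zero, zero_smul, smul_zero, sub_zero,
    NormedSpace.exp_zero, Real.norm_eq_abs] at h1 h2
  have hq := expCurve_mem hs hY.1 (t - s)
  obtain ⟨v, hv, hv1, hv2, hv3⟩ := exists_unitary_of_norm_sub_le hq ht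
    (by rw [norm_sub_rev]; exact h1.trans h3)
  rw [norm_sub_rev (expCurve _ _ _)] at hv3
  have he := exp_mem_transporters (p := η s) hY.1 (t - s)
  refine ⟨_, mul_mem_transporters ⟨hv, hv1, hv2⟩ he, ?_⟩
  set e := NormedSpace.exp ((t - s) • Y)
  have h4 : ‖e - 1‖ ≤ ε * |t - s| + |t - s| * ‖Y‖ := by
    have : e - 1 = (e - 1 - (t - s) • Y) + (t - s) • Y := by abel
    rw [this]
    exact norm_add_le_of_le h2 (by rw [norm_smul, Real.norm_eq_abs])
  have h5 : v * e - 1 = (v - 1) * e + (e - 1) := by noncomm_ring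
  rw [h5]
  refine (norm_add_le _ _).trans ?_
  rw [CStarRing.norm_mul_mem_unitary _ he.1]
  have : c = 40 * ε + ‖Y‖ := by rw [hε]; ring
  rw [this]
  nlinarith [mul_nonneg hε0.le (abs_nonneg (t - s))]

lemma abs_deriv_orbitAngle_le_norm (hφ : IsPositiveFunctional φ) (h1 : φ 1 = 1)
    (hw : w ∈ unitary (H →L[ℂ] H)) {η : ℝ → (H →L[ℂ] H) × H} {V : (H →L[ℂ] H) × H} {s g' : ℝ}
    {Y : H →L[ℂ] H} (hd : HasDerivAt η V s)
    (hη : ∀ᶠ t in nhds s, η t ∈ canonicalSphereBundle H) (hY : IsLifting (η s) V Y)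
    (hg : HasDerivAt (fun t => orbitAngle φ p w (η t)) g' s) : |g'| ≤ ‖Y‖ := by
  have key : ∀ ε : ℝ, 0 < ε → |g'| ≤ (1 + ε) * (‖Y‖ + ε) := by
    intro ε hε
    obtain ⟨δ, hδ, hδ'⟩ := Real.eventually_arccos_one_sub_sq_div_two_le (c := 1 + ε) (by linarith)
    refine hg.le_of_lip' (by positivity) ?_
    have h3 : ∀ᶠ t in nhds s, (‖Y‖ + ε) * |t - s| < δ := by
      have : ContinuousAt (fun t : ℝ => (‖Y‖ + ε) * |t - s|) s := by fun_prop
      exact this.eventually_lt continuousAt_const (by simpa using hδ)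
    filter_upwards [eventually_exists_transporter hd hη hY (c := ‖Y‖ + ε) (by linarith), h3]
      with t ⟨r, hr, hr'⟩ ht
    refine (abs_orbitAngle_sub_le hφ h1 hw hr).trans ?_
    refine (hδ' _ (norm_nonneg _) (hr'.trans_lt ht)).trans ?_
    rw [mul_assoc]
    gcongr
    exact hr'
  have hlim : Filter.Tendsto (fun ε : ℝ => (1 + ε) * (‖Y‖ + ε)) (nhdsWithin 0 (Set.Ioi 0))
      (nhds ((1 + 0) * (‖Y‖ + 0))) :=
    tendsto_nhdsWithin_of_tendsto_nhds (Continuous.tendsto (by fun_prop) 0)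
  rw [add_zero, one_mul, add_zero] at hlim
  exact ge_of_tendsto hlim (eventually_nhdsWithin_of_forall key)

lemma abs_deriv_orbitAngle_le (hφ : IsPositiveFunctional φ) (h1 : φ 1 = 1)
    (hw : w ∈ unitary (H →L[ℂ] H)) {η : ℝ → (H →L[ℂ] H) × H} {V : (H →L[ℂ] H) × H} {s g' : ℝ}
    (hd : HasDerivAt η V s) (hη : ∀ᶠ t in nhds s, η t ∈ canonicalSphereBundle H)
    (hg : HasDerivAt (fun t => orbitAngle φ p w (η t)) g' s) : |g'| ≤ finslerNorm (η s) V := by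
  -- Existence of a lifting is essential: an infimum over the empty set would be `0`.
  obtain ⟨Y, hY⟩ := exists_isLifting_of_hasDerivAt hd hη
  refine le_csInf ⟨_, Y, hY, rfl⟩ ?_
  rintro _ ⟨Z, hZ, rfl⟩
  exact abs_deriv_orbitAngle_le_norm hφ h1 hw hd hη hZ hg

end derivative

end canonicalSphereBundle

/-! ### Integration along piecewise smooth curves -/

namespace canonicalSphereBundle

open MeasureTheory

variable {H : Type*} [NormedAddCommGroup H] [InnerProductSpace ℂ H] [CompleteSpace H]
  {φ : (H →L[ℂ] H) →L[ℝ] ℝ} {p : (H →L[ℂ] H) × H} {w X : H →L[ℂ] H}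
  {η : ℝ → (H →L[ℂ] H) × H}

/-- The angle along the curve is Lipschitz, hence absolutely continuous, so it is the integral of
its almost everywhere derivative, which the Finsler speed bounds. -/
lemma ofReal_orbitAngle_sub_le_of_contDiffOn (hφ : IsPositiveFunctional φ) (h1 : φ 1 = 1)
    (hw : w ∈ unitary (H →L[ℂ] H)) {c d : ℝ} (hcd : c ≤ d)
    (hη : ∀ t ∈ Set.Icc c d, η t ∈ canonicalSphereBundle H)
    (hsm : ContDiffOn ℝ ∞ η (Set.Icc c d)) :
    ENNReal.ofReal (orbitAngle φ p w (η c) - orbitAngle φ p w (η d)) ≤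
      ∫⁻ t in Set.Ioc c d, ENNReal.ofReal (finslerNorm (η t) (deriv η t)) := by
  set g : ℝ → ℝ := fun t => orbitAngle φ p w (η t) with hg
  obtain ⟨K, hK⟩ := hsm.exists_lipschitzOnWith (by simp) (convex_Icc c d) isCompact_Icc
  have hlip : LipschitzOnWith (Real.toNNReal (10 * Real.pi) * K) g (Set.uIcc c d) := by
    rw [Set.uIcc_of_le hcd]
    refine LipschitzOnWith.of_dist_le_mul fun x hx y hy => ?_
    rw [NNReal.coe_mul, Real.coe_toNNReal _ (by positivity), Real.dist_eq]
    refine (abs_orbitAngle_sub_le_mul_norm hφ h1 hw (hη y hy) (hη x hx)).trans ?_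
    rw [← dist_eq_norm, mul_assoc (10 * Real.pi)]
    exact mul_le_mul_of_nonneg_left (hK.dist_le_mul x hx y hy) (by positivity)
  have hac := hlip.absolutelyContinuousOnInterval
  have hint := hac.integral_deriv_eq_sub
  rw [intervalIntegral.integral_of_le hcd, integral_Ioc_eq_integral_Ioo] at hint
  calc ENNReal.ofReal (g c - g d) ≤ ‖g c - g d‖ₑ := Real.ofReal_le_enorm _
    _ = ‖∫ t in Set.Ioo c d, deriv g t‖ₑ := by rw [hint, ← enorm_neg, neg_sub]
    _ ≤ ∫⁻ t in Set.Ioo c d, ‖deriv g t‖ₑ := enorm_integral_le_lintegral_enorm _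
    _ ≤ ∫⁻ t in Set.Ioo c d, ENNReal.ofReal (finslerNorm (η t) (deriv η t)) := by
      refine lintegral_mono_ae ((ae_restrict_iff' measurableSet_Ioo).2 ?_)
      filter_upwards [hac.ae_differentiableAt] with t ht htm
      have hnhds : Set.Icc c d ∈ nhds t := Icc_mem_nhds htm.1 htm.2
      have hdη := ((hsm.contDiffAt hnhds).differentiableAt (by simp)).hasDerivAt
      have hdg := (ht (Set.uIcc_of_le hcd ▸ Set.Ioo_subset_Icc_self htm)).hasDerivAt
      rw [Real.enorm_eq_ofReal_abs]
      exact ENNReal.ofReal_le_ofReal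
        (abs_deriv_orbitAngle_le hφ h1 hw hdη (Filter.mem_of_superset hnhds hη) hdg)
    _ ≤ _ := lintegral_mono_set Set.Ioo_subset_Ioc_self

lemma ofReal_orbitAngle_sub_le_of_piecewise (hφ : IsPositiveFunctional φ) (h1 : φ 1 = 1)
    (hw : w ∈ unitary (H →L[ℂ] H)) (s : Finset ℝ) {c d : ℝ} (hcd : c ≤ d)
    (hη : ∀ t ∈ Set.Icc c d, η t ∈ canonicalSphereBundle H)
    (hsm : ∀ c' d' : ℝ, c ≤ c' → c' < d' → d' ≤ d → (∀ t ∈ s, t ∉ Set.Ioo c' d') →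
      ContDiffOn ℝ ∞ η (Set.Icc c' d')) :
    ENNReal.ofReal (orbitAngle φ p w (η c) - orbitAngle φ p w (η d)) ≤
      ∫⁻ t in Set.Ioc c d, ENNReal.ofReal (finslerNorm (η t) (deriv η t)) := by
  induction s using Finset.induction_on generalizing c d with
  | empty =>
    rcases hcd.eq_or_lt with rfl | hlt
    · simp
    · exact ofReal_orbitAngle_sub_le_of_contDiffOn hφ h1 hw hcd hη
        (hsm c d le_rfl hlt le_rfl (by simp))
  | insert a s _ ih =>
    by_cases ha : a ∈ Set.Ioo c d
    · have hl := ih ha.1.le (fun t ht => hη t ⟨ht.1, ht.2.trans ha.2.le⟩)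
        fun c' d' hc hcd' hd hs => hsm c' d' hc hcd' (hd.trans ha.2.le)
          (Finset.forall_mem_insert _ _ _ |>.2 ⟨fun h => absurd h.2 hd.not_gt, hs⟩)
      have hr := ih ha.2.le (fun t ht => hη t ⟨ha.1.le.trans ht.1, ht.2⟩)
        fun c' d' hc hcd' hd hs => hsm c' d' (ha.1.le.trans hc) hcd' hd
          (Finset.forall_mem_insert _ _ _ |>.2 ⟨fun h => absurd h.1 hc.not_gt, hs⟩)
      rw [← Set.Ioc_union_Ioc_eq_Ioc ha.1.le ha.2.le, lintegral_union measurableSet_Ioc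
        (Set.Ioc_disjoint_Ioc_of_le le_rfl)]
      refine le_trans ?_ (add_le_add hl hr)
      refine le_trans (ENNReal.ofReal_le_ofReal (le_of_eq ?_)) ENNReal.ofReal_add_le
      ring
    · refine ih hcd hη fun c' d' hc hcd' hd hs => hsm c' d' hc hcd' hd
        (Finset.forall_mem_insert _ _ _ |>.2 ⟨fun h => ha ?_, hs⟩)
      exact ⟨hc.trans_lt h.1, h.2.trans_le hd⟩

lemma ofReal_orbitAngle_sub_le_length (hφ : IsPositiveFunctional φ) (h1 : φ 1 = 1)
    (hw : w ∈ unitary (H →L[ℂ] H)) {c d : ℝ} (hη : IsPiecewiseSmoothCurve η c d) :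
    ENNReal.ofReal (orbitAngle φ p w (η c) - orbitAngle φ p w (η d)) ≤ length η c d := by
  obtain ⟨hcd, hmem, -, s, hs⟩ := hη
  exact (ofReal_orbitAngle_sub_le_of_piecewise hφ h1 hw s hcd hmem hs).trans
    (lintegral_mono_set Set.Ioc_subset_Icc_self)

/-! ### The great circle, the isotropy algebra and the conclusion -/

lemma apply_mul_exp_real_smul (hsq : ∀ c, φ (c * (X * X)) = -φ c) (c : H →L[ℂ] H) (t : ℝ) :
    φ (c * NormedSpace.exp (t • X)) = Real.cos t * φ c + Real.sin t * φ (c * X) := by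
  set y : ℝ → ℝ := fun t => φ (c * NormedSpace.exp (t • X)) with hy
  set z : ℝ → ℝ := fun t => φ (c * (NormedSpace.exp (t • X) * X)) with hz
  have hyd : ∀ t, HasDerivAt y (z t) t := fun t =>
    φ.hasFDerivAt.comp_hasDerivAt t ((hasDerivAt_exp_smul_const (𝕂 := ℝ) X t).const_mul c)
  have hzd : ∀ t, HasDerivAt z (-y t) t := fun t => by
    have h := φ.hasFDerivAt.comp_hasDerivAt t
      (((hasDerivAt_exp_smul_const (𝕂 := ℝ) X t).mul_const X).const_mul c)
    rwa [mul_assoc, ← mul_assoc c, hsq] at h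
  -- From `y' = z` and `z' = -y`, the pair `(y, z)` rotated back by the angle `t` is constant.
  have hF : ∀ t, y t * Real.cos t - z t * Real.sin t = y 0 * Real.cos 0 - z 0 * Real.sin 0 := by
    have hd : ∀ t, HasDerivAt (fun t => y t * Real.cos t - z t * Real.sin t) 0 t := fun t => by
      have h := ((hyd t).mul (Real.hasDerivAt_cos t)).sub ((hzd t).mul (Real.hasDerivAt_sin t))
      exact HasDerivAt.congr_deriv (f := fun t => y t * Real.cos t - z t * Real.sin t) h (by ring)
    exact fun t => is_const_of_deriv_eq_zero (fun t => (hd t).differentiableAt)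
      (fun t => (hd t).deriv) t 0
  have hG : ∀ t, y t * Real.sin t + z t * Real.cos t = y 0 * Real.sin 0 + z 0 * Real.cos 0 := by
    have hd : ∀ t, HasDerivAt (fun t => y t * Real.sin t + z t * Real.cos t) 0 t := fun t => by
      have h := ((hyd t).mul (Real.hasDerivAt_sin t)).add ((hzd t).mul (Real.hasDerivAt_cos t))
      exact HasDerivAt.congr_deriv (f := fun t => y t * Real.sin t + z t * Real.cos t) h (by ring)
    exact fun t => is_const_of_deriv_eq_zero (fun t => (hd t).differentiableAt)
      (fun t => (hd t).deriv) t 0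
  have hF := hF t
  have hG := hG t
  have hy0 : y 0 = φ c := by simp [hy]
  have hz0 : z 0 = φ (c * X) := by simp [hz]
  simp only [Real.cos_zero, Real.sin_zero, mul_one, mul_zero, sub_zero, zero_add, hy0, hz0] at hF hG
  change y t = _
  rw [← hF, ← hG]
  linear_combination (-y t) * Real.sin_sq_add_cos_sq t

/-- The complexified isotropy algebra at `p`: operators commuting with the projection of `p` which
annihilate, together with their adjoints, the unit vector of `p`. -/
def isotropyAlgebra (p : (H →L[ℂ] H) × H) : Submodule ℂ (H →L[ℂ] H) where
  carrier := {b | b * p.1 = p.1 * b ∧ b p.2 = 0 ∧ (star b) p.2 = 0}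
  add_mem' := by
    rintro a b ⟨ha, ha', ha''⟩ ⟨hb, hb', hb''⟩
    exact ⟨by rw [add_mul, mul_add, ha, hb], by simp [ha', hb'], by simp [ha'', hb'']⟩
  zero_mem' := by simp
  smul_mem' := by
    rintro c b ⟨hb, hb', hb''⟩
    exact ⟨by rw [smul_mul_assoc, mul_smul_comm, hb], by simp [hb'], by simp [star_smul, hb'']⟩

lemma star_mem_isotropyAlgebra (hp : p ∈ canonicalSphereBundle H) {b : H →L[ℂ] H}
    (hb : b ∈ isotropyAlgebra p) : star b ∈ isotropyAlgebra p := by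
  refine ⟨?_, hb.2.2, by rw [star_star]; exact hb.2.1⟩
  have := congrArg star hb.1
  rwa [star_mul, star_mul, hp.1.isSelfAdjoint.star_eq, eq_comm] at this

/-- Being linear, the equations of the stabilizer pass orthogonality from the algebra to the whole
group. As `star u - 1` need not be skew, the algebra has to be complexified. -/
lemma star_sub_one_mem_isotropyAlgebra {u : H →L[ℂ] H} (hu : u ∈ transporters p p) :
    star u - 1 ∈ isotropyAlgebra p := by
  have h := star_mem_transporters hu
  refine ⟨?_, ?_, ?_⟩
  · rw [sub_mul, mul_sub, h.2.1, one_mul, mul_one]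
  · simp [h.2.2]
  · simp [hu.2.2]

lemma le_orbitAngle (hφ : IsPositiveFunctional φ) (h1 : φ 1 = 1)
    (hX : X ∈ skewAdjoint (H →L[ℂ] H)) (hsq : ∀ c, φ (c * (X * X)) = -φ c)
    (horth : ∀ b ∈ isotropyAlgebra p, φ (b * X) = 0) {t : ℝ} (ht0 : 0 ≤ t)
    (ht : t ≤ Real.pi / 2) : t ≤ orbitAngle φ p (NormedSpace.exp (t • X)) p := by
  refine le_csInf ⟨_, 1, ⟨one_mem _, by simp, by simp⟩, rfl⟩ ?_
  rintro _ ⟨u, hu, rfl⟩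
  have h2 : φ (star u * X) = 0 := by
    have h3 := horth _ (star_sub_one_mem_isotropyAlgebra hu)
    rwa [sub_mul, one_mul, map_sub, hφ.apply_eq_zero_of_star_eq_neg (skewAdjoint.mem_iff.1 hX),
      sub_zero] at h3
  have h4 : φ (star u) ≤ 1 := by
    have h5 := hφ.apply_star_mul_sq_le u 1
    rw [mul_one, star_one, mul_one, h1, IsPositiveFunctional.apply_star_mul_self_of_mem_unitary h1
      hu.1] at h5
    nlinarith
  -- Here `t ≤ π / 2` is decisive: `φ (star u) ≤ 1` gives `cos t * φ (star u) ≤ cos t` only if `cos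
  -- t` is nonnegative.
  have hcos : 0 ≤ Real.cos t := Real.cos_nonneg_of_mem_Icc ⟨by linarith [Real.pi_pos], ht⟩
  dsimp only
  rw [apply_mul_exp_real_smul hsq, h2, mul_zero, add_zero]
  calc t = Real.arccos (Real.cos t) := (Real.arccos_cos ht0 (by linarith [Real.pi_pos])).symm
    _ ≤ _ := Real.arccos_le_arccos (by nlinarith)

/-- A lower bound for the length of the curves joining `p` to `e^{tX} · p`. -/
lemma ofReal_le_length (hp : p ∈ canonicalSphereBundle H) (hX : X ∈ skewAdjoint (H →L[ℂ] H))
    (hn : ‖X‖ = 1) (hmin : ∀ b ∈ isotropyAlgebra p, star b = -b → 1 ≤ ‖X + b‖) {t : ℝ}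
    (ht0 : 0 ≤ t) (ht : t ≤ Real.pi / 2) {c d : ℝ} (hη : IsPiecewiseSmoothCurve η c d)
    (hc : η c = p) (hd : η d = expCurve p X t) : ENNReal.ofReal t ≤ length η c d := by
  obtain ⟨φ, hφ, h1, hsq, horth⟩ := exists_state_of_norm_le_norm_add (skewAdjoint.mem_iff.1 hX) hn
    (isotropyAlgebra p) (fun b hb => star_mem_isotropyAlgebra hp hb) hmin
  have hw := exp_real_smul_mem_unitary hX t
  refine le_trans (ENNReal.ofReal_le_ofReal ?_)
    (ofReal_orbitAngle_sub_le_length (p := p) hφ h1 hw hη)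
  have h2 := le_orbitAngle hφ h1 hX hsq horth ht0 ht
  have h3 := orbitAngle_le (φ := φ) (w := NormedSpace.exp (t • X))
    (exp_mem_transporters (p := p) hX t)
  rw [IsPositiveFunctional.apply_star_mul_self_of_mem_unitary h1 hw, Real.arccos_one] at h3
  rw [hc, hd]
  linarith

/-- Since `e^{aX}` commutes with `X`, conjugation by it turns `X + b` into a lifting of `V` at `p`
of the same norm. Any point of the curve can thus serve as starting point. -/
lemma one_le_norm_add_of_isMinimalLifting {V : (H →L[ℂ] H) × H} (hX : IsMinimalLifting p V X)
    (hn : ‖X‖ = 1) (a : ℝ) {b : H →L[ℂ] H} (hb : b ∈ isotropyAlgebra (expCurve p X a))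
    (hbs : star b = -b) : 1 ≤ ‖X + b‖ := by
  set e := NormedSpace.exp (a • X) with he
  have hXs := hX.1.1
  have heu := exp_mem_transporters (p := p) hXs a
  have hse := star_mem_transporters heu
  rw [← he] at heu hse
  have hcX : star e * X * e = X := by
    have hc : X * e = e * X := (((Commute.refl X).smul_right a).exp_right).eq
    rw [mul_assoc, hc, ← mul_assoc, Unitary.star_mul_self_of_mem heu.1, one_mul]
  have hlift : IsLifting p V (X + star e * b * e) := by
    refine ⟨?_, ?_⟩
    · rw [skewAdjoint.mem_iff] at hXs ⊢
      simp only [star_add, star_mul, star_star, hbs, hXs]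
      noncomm_ring
    · rw [map_add, hX.1.2, add_eq_left]
      have h1 : star e * b * e * p.1 - p.1 * (star e * b * e) = 0 := by
        rw [sub_eq_zero, mul_assoc, heu.2.1, mul_assoc (star e), ← mul_assoc b, hb.1, ← mul_assoc,
          ← mul_assoc, hse.2.1]
        simp only [mul_assoc]
      have h2 : (star e * b * e) p.2 = 0 := by
        rw [mul_apply_eq_comp, heu.2.2, mul_apply_eq_comp, hb.2.1, map_zero]
      exact Prod.ext h1 h2
  have h3 := finslerNorm_le hlift
  rw [← hX.2, hn] at h3
  have h4 : X + star e * b * e = star e * (X + b) * e := by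
    rw [mul_add, add_mul, hcX]
  rwa [h4, CStarRing.norm_mul_mem_unitary _ heu.1, CStarRing.norm_mem_unitary_mul _ hse.1] at h3

lemma length_expCurve_le (hX : X ∈ skewAdjoint (H →L[ℂ] H)) (hn : ‖X‖ = 1) (a b : ℝ) :
    length (expCurve p X) a b ≤ ENNReal.ofReal (b - a) := by
  have h : ∀ t, ENNReal.ofReal (finslerNorm (expCurve p X t) (deriv (expCurve p X) t)) ≤ 1 := by
    intro t
    have hl : IsLifting (expCurve p X t) (infinitesimalAction (expCurve p X t) X) X := ⟨hX, rfl⟩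
    have hd := (hasDerivAt_expCurve (p := p) (X := X) t).deriv
    rw [ENNReal.ofReal_le_one, hd]
    exact (finslerNorm_le hl).trans_eq hn
  have hv : ∫⁻ _ in Set.Icc a b, (1 : ENNReal) = ENNReal.ofReal (b - a) := by
    rw [setLIntegral_one, Real.volume_Icc]
  exact (lintegral_mono h).trans_eq hv

lemma hasMinimalLength_expCurve (hp : p ∈ canonicalSphereBundle H) {V : (H →L[ℂ] H) × H}
    (hX : IsMinimalLifting p V X) (hn : ‖X‖ = 1) {a b : ℝ} (hab : a ≤ b)
    (hba : b - a ≤ Real.pi / 2) : HasMinimalLength (expCurve p X) a b := by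
  refine ⟨⟨hab, fun t _ => expCurve_mem hp hX.1.1 t,
    (contDiff_expCurve (n := 0)).continuous.continuousOn, ∅, fun c d _ _ _ _ => contDiff_expCurve.contDiffOn⟩, fun η c d hη hc hd => ?_⟩
  refine (length_expCurve_le hX.1.1 hn a b).trans ?_
  refine ofReal_le_length (expCurve_mem hp hX.1.1 a) hX.1.1 hn
    (fun b' hb' hs => one_le_norm_add_of_isMinimalLifting hX hn a hb' hs)
    (sub_nonneg.2 hab) hba hη hc ?_
  rw [hd, expCurve_expCurve, add_sub_cancel]

end canonicalSphereBundle

theorem mainTheorem2 {H : Type*} [NormedAddCommGroup H] [InnerProductSpace ℂ H] [CompleteSpace H]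
    (P₀ : H →L[ℂ] H) (f₀ : H) (hp : (P₀, f₀) ∈ canonicalSphereBundle H)
    (V : (H →L[ℂ] H) × H) (hV : V ∈ canonicalSphereBundle.tangentSpace (P₀, f₀))
    (hV1 : canonicalSphereBundle.finslerNorm (P₀, f₀) V = 1)
    (X₀ : H →L[ℂ] H) (hX₀ : canonicalSphereBundle.IsMinimalLifting (P₀, f₀) V X₀) :
    (∀ t : ℝ, |t| ≤ Real.pi / 2 →
      canonicalSphereBundle.HasMinimalLength
        (canonicalSphereBundle.expCurve (P₀, f₀) X₀) (min 0 t) (max 0 t)) ∧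
    (∀ a b : ℝ, a ≤ b → b - a ≤ Real.pi / 2 →
      canonicalSphereBundle.HasMinimalLength
        (canonicalSphereBundle.expCurve (P₀, f₀) X₀) a b) := by
  have hn : ‖X₀‖ = 1 := hX₀.2.trans hV1
  have h := fun a b (hab : a ≤ b) (hba : b - a ≤ Real.pi / 2) =>
    canonicalSphereBundle.hasMinimalLength_expCurve hp hX₀ hn hab hba
  refine ⟨fun t ht => h _ _ min_le_max ?_, h⟩
  rwa [max_sub_min_eq_abs, sub_zero]
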